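/- Let $(\Omega,\mathcal F,\mathbb P)$ be a probability space and $\mathbb X=\{X_k(r): r\in[0,\infty),\ k\in\mathbb N\}$, $\mathbb N=\{1,2,\dots\}$, a family of integrable real random variables such that the processes $(X_k(r))_{r\ge 0}$, $k\in\mathbb N$, are independent. Let $\mathbf m=(m_k)_{k\in\mathbb N}\in[0,\infty)^{\mathbb N}$ with $\sum_k m_k=\infty$. Put $M_n=\sum_{k=1}^n m_k$ and, for $t>0$, $\ell_t=\inf\{\ell: M_\ell\ge t\}$, $\bar t=t-M_{\ell_t-1}$, $$\mathcal S_t=\sum_{k=1}^{\ell_t-1}\frac{m_k}{t}X_k(m_k)+\frac{\bar t}{t}X_{\ell_t}(\bar t),\qquad \mu_t=\sum_{k=1}^{\ell_t-1}\frac{m_k}{t}\,\delta_{m_k}+\frac{\bar t}{t}\,\delta_{\bar t},$$ where $\mu_t$ is a measure on the compact space $[0,\infty]$. A family $\mathbb Y=\{Y_k(r)\}$ is said to satisfy (S1)–(S3) if: (S1) there is $\delta>0$ such that for every $\varepsilon>0$ there is $C$ with $\sup_k\mathbb P(|Y_k(r)|>\varepsilon)<C/r^{\delta}$ for all $r>0$;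 (S2) there are $\gamma>0$ and a random variable $X_*$ with $\mathbb E[|X_*|^{2+\gamma}]<\infty$ and $\sup_{k,r}\mathbb P(Y_k(r)>x)\le\mathbb P(X_*>x)$ for all $x\in\mathbb R$ (here $X_*$ may live on another probability space); (S3) for every $\varepsilon>0$ there are $\beta>1$ and $C_\varepsilon>0$ such that for all $t,r,h>0$ $$\sup_k\mathbb P\Big(\sup_{0\le s\le h}\big|(r+s)Y_k(r+s)-rY_k(r)\big|\ge t\varepsilon\Big)\le\frac{C_\varepsilon h^{\beta}}{t^{\beta}}.$$ Assume that $\mathbb X$, or else the centred family $\{X_k(r)-\mathbb E[X_k(r)]\}$, satisfies (S1)–(S3), and that there is a bounded continuous function $r\mapsto v_r$ on $[0,\infty]$ with $\mathbb E[X_k(r)]=v_r$ for all $k\in\mathbb N$ and $r\in[0,\infty)$. Then: 1. For every $t>0$, $\mathcal S_t$ is integrable and $\mathbb E[\mathcal S_t]=\int v_r\,d\mu_t(r)$. 2. If $\mathbf m$ is regular, i.e. there is a probability measure $\mu_*$ on $[0,\infty]$ with $\int f\,d\mu_t\to\int f\,d\mu_*$ as $t\to\infty$ for every continuous $f:[0,\infty]\to\mathbb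 R$, then $$\mathbb P\Big(\lim_{t\to\infty}\mathcal S_t=\int v_r\,d\mu_*(r)\Big)=1 .$$ -/

import Mathlib

open MeasureTheory ProbabilityTheory Filter Topology
open scoped NNReal ENNReal BoundedContinuousFunction

noncomputable section

namespace GameOfMass

/-! Sequences are indexed from `0`: `m k` and `X k` stand for the `(k+1)`-st mass and the
`(k+1)`-st one-parameter family. A family `X k r`, `r ∈ [0,∞)`, is a map `ℕ → ℝ≥0 → Ω → ℝ`. -/

/-- The sum `M n` of the first `n` masses. -/
def cumMass (m : ℕ → ℝ≥0) (n : ℕ) : ℝ≥0 := ∑ k ∈ Finset.range n, m k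

/-- `ℓ_t = inf {ℓ : M ℓ ≥ t}`. The total mass is infinite where this is used, so the set is
nonempty; for `t > 0` it does not contain `0`, since `M 0 = 0`. -/
def ell (m : ℕ → ℝ≥0) (t : ℝ≥0) : ℕ := sInf {l : ℕ | t ≤ cumMass m l}

/-- `t - M (ℓ_t - 1)`, the elapsed part of the current increment. For `t > 0` it is positive, by
minimality of `ℓ_t`, so the subtraction does not truncate. -/
def tbar (m : ℕ → ℝ≥0) (t : ℝ≥0) : ℝ≥0 := t - cumMass m (ell m t - 1)

/-- The gradual sum: the first `ℓ_t - 1` families at their full masses, and the `ℓ_t`-th family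
(which has index `ℓ_t - 1` here) at the elapsed part of its mass. -/
def gradualSum {Ω : Type*} (X : ℕ → ℝ≥0 → Ω → ℝ) (m : ℕ → ℝ≥0) (t : ℝ≥0) (ω : Ω) : ℝ :=
  ∑ k ∈ Finset.range (ell m t - 1), (m k : ℝ) / (t : ℝ) * X k (m k) ω
    + (tbar m t : ℝ) / (t : ℝ) * X (ell m t - 1) (tbar m t) ω

/-- The empirical mass measure on `[0,∞]`. -/
def empMeasure (m : ℕ → ℝ≥0) (t : ℝ≥0) : Measure ℝ≥0∞ :=
  (tbar m t / t) • Measure.dirac (tbar m t : ℝ≥0∞)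
    + ∑ k ∈ Finset.range (ell m t - 1), (m k / t) • Measure.dirac (m k : ℝ≥0∞)

/-- Weak convergence on the compact space `[0,∞]`, as `t → ∞`. -/
def ConvergesWeakly (lam : ℝ≥0 → Measure ℝ≥0∞) (lamStar : Measure ℝ≥0∞) : Prop :=
  ∀ f : ℝ≥0∞ →ᵇ ℝ, Tendsto (fun t => ∫ x, f x ∂(lam t)) atTop (𝓝 (∫ x, f x ∂lamStar))

section Conditions

variable {Ω : Type*} [MeasurableSpace Ω]

/-- Polynomial decay. -/
def PolynomialDecay (P : Measure Ω) (X : ℕ → ℝ≥0 → Ω → ℝ) : Prop :=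
  ∃ δ : ℝ, 0 < δ ∧ ∀ ε : ℝ, 0 < ε → ∃ C : ℝ, ∀ r : ℝ≥0, 0 < r →
    (⨆ k, P {ω | ε < |X k r ω|}) < ENNReal.ofReal (C / (r : ℝ) ^ δ)

/-- Stochastic domination and moment control; `ν` is the law of the dominating variable. -/
def StochasticDomination (P : Measure Ω) (X : ℕ → ℝ≥0 → Ω → ℝ) : Prop :=
  ∃ (ν : Measure ℝ) (γ : ℝ), IsProbabilityMeasure ν ∧ 0 < γ ∧
    (∫⁻ x, ENNReal.ofReal (|x| ^ (2 + γ)) ∂ν) < ∞ ∧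
    ∀ x : ℝ, (⨆ k, ⨆ r, P {ω | x < X k r ω}) ≤ ν (Set.Ioi x)

/-- Slow relative increment growth. The inner supremum over `s ∈ [0,h]` is taken in `[0,∞]`. -/
def SlowIncrementGrowth (P : Measure Ω) (X : ℕ → ℝ≥0 → Ω → ℝ) : Prop :=
  ∀ ε : ℝ, 0 < ε → ∃ β C : ℝ, 1 < β ∧ 0 < C ∧ ∀ t r h : ℝ≥0, 0 < t → 0 < r → 0 < h →
    (⨆ k, P {ω | ENNReal.ofReal ((t : ℝ) * ε) ≤
        ⨆ s ∈ Set.Icc (0 : ℝ≥0) h,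
          ENNReal.ofReal |((r : ℝ) + s) * X k (r + s) ω - (r : ℝ) * X k r ω|})
      ≤ ENNReal.ofReal (C * (h : ℝ) ^ β / (t : ℝ) ^ β)

/-- The three conditions of the strong law for the gradual sum. -/
def StrongConditions (P : Measure Ω) (X : ℕ → ℝ≥0 → Ω → ℝ) : Prop :=
  PolynomialDecay P X ∧ StochasticDomination P X ∧ SlowIncrementGrowth P X

/-- The centred family `X k r - E[X k r]`. -/
def centred (P : Measure Ω) (X : ℕ → ℝ≥0 → Ω → ℝ) : ℕ → ℝ≥0 → Ω → ℝ :=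
  fun k r ω => X k r ω - ∫ ω', X k r ω' ∂P

end Conditions

end GameOfMass

end

/-! Centring subtracts exactly `∫ v dμ_t` from the gradual sum, so by weak convergence it suffices
that the gradual sum of a centred family `Y` tends to `0` almost surely.

Slow increment growth does most of the work. Stochastic domination serves only to bound first
moments, whence `r * Y k r → 0` along `r = 2⁻ⁿ` and the increment bound extends to `r = 0`. By
scaling, that bound gives tails of order `x ^ (-β)` with `β > 1`, hence uniform `p`-th moments for
some `p ∈ (1, 2)`.

Completed masses (`ae_isLittleO_sum_mul`): a mass is light or heavy according to its size relative
to a power, slightly below one, of the cumulative mass. For light masses the `p`-th moments of `m k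
* Y k (m k) / M` are summable, so the random series converges and Kronecker's lemma applies. For
heavy masses polynomial decay and Borel–Cantelli make `Y k (m k)` eventually small.

Unfinished mass (`ae_eventually_abs_tbar_mul_le`): on a polynomial time grid, Borel–Cantelli
controls both the value at each grid time and the fluctuations between consecutive grid times.

If the conditions hold for `X` itself, polynomial decay and the moment bound force `v ∞ = 0`, and
the tail and increment bounds pass to the centred family. -/

namespace GameOfMass

/-! ### Almost sure convergence of random series, and moments from tails. -/

section Series

/-- A series of functions whose absolute integrals are summable converges absolutely a.e. -/
theorem ae_summable_of_tsum_lintegral_ne_top {Ω : Type*} [MeasurableSpace Ω] {P : Measure Ω}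
    {f : ℕ → Ω → ℝ} (hf : ∀ k, Measurable (f k))
    (h : ∑' k, ∫⁻ ω, ENNReal.ofReal |f k ω| ∂P ≠ ∞) :
    ∀ᵐ ω ∂P, Summable fun k => f k ω := by
  simp only [← Real.norm_eq_abs] at h
  rw [← lintegral_tsum fun k => (hf k).norm.ennreal_ofReal.aemeasurable] at h
  filter_upwards [ae_lt_top (Measurable.tsum fun k => (hf k).norm.ennreal_ofReal) h]
    with ω hω
  refine Summable.of_norm ?_
  have := ENNReal.summable_toReal hω.ne
  refine this.congr fun k => ?_
  rw [ENNReal.toReal_ofReal (norm_nonneg _)]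

variable {Ω : Type*} [MeasurableSpace Ω] {P : Measure Ω} [IsProbabilityMeasure P]

/-- A series of independent centred square integrable variables whose variances are summable
converges almost surely. -/
theorem ae_exists_tendsto_sum_of_summable_variance {η : ℕ → Ω → ℝ}
    (hmeas : ∀ k, Measurable (η k)) (hL2 : ∀ k, MemLp (η k) 2 P) (hind : iIndepFun η P)
    (hmean : ∀ k, ∫ ω, η k ω ∂P = 0) (hsum : Summable fun k => Var[η k; P]) :
    ∀ᵐ ω ∂P, ∃ c, Tendsto (fun n => ∑ k ∈ Finset.range n, η k ω) atTop (𝓝 c) := by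
  have hsm : ∀ k, StronglyMeasurable (η k) := fun k => (hmeas k).stronglyMeasurable
  have hint : ∀ k, Integrable (η k) P := fun k => (hL2 k).integrable (by norm_num)
  -- The sum runs up to index `n` inclusive, to match the natural filtration at time `n`.
  set S : ℕ → Ω → ℝ := fun n => ∑ k ∈ Finset.range (n + 1), η k with hS
  have hSint : ∀ n, Integrable (S n) P := fun n => integrable_finsetSum' _ fun k _ => hint k
  have hadp : StronglyAdapted (Filtration.natural η hsm) S := fun n =>
    Finset.stronglyMeasurable_sum _ fun k hk =>
      (Filtration.stronglyAdapted_natural hsm k).mono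
        ((Filtration.natural η hsm).mono (Nat.lt_succ_iff.mp (Finset.mem_range.mp hk)))
  have hmart : Martingale S (Filtration.natural η hsm) P := by
    refine martingale_nat hadp hSint fun n => ?_
    have h1 : S (n + 1) = S n + η (n + 1) := by
      simp only [hS]; rw [Finset.sum_range_succ _ (n + 1)]
    have h2 := condExp_add (hSint n) (hint (n + 1)) (Filtration.natural η hsm n)
    have h3 := hind.condExp_natural_ae_eq_of_lt hsm (Nat.lt_succ_self n)
    rw [h1]
    filter_upwards [h2, h3] with ω h2 h3
    rw [h2, Pi.add_apply, h3, hmean,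
      condExp_of_stronglyMeasurable ((Filtration.natural η hsm).le n) (hadp n) (hSint n), add_zero]
  have hSL2 : ∀ n, MemLp (S n) 2 P := fun n => memLp_finsetSum' _ fun k _ => hL2 k
  have hvar : ∀ n, ∫ ω, S n ω ^ 2 ∂P ≤ ∑' k, Var[η k; P] := by
    intro n
    have h1 : ∫ ω, S n ω ∂P = 0 := by
      simp only [hS, Finset.sum_apply]
      rw [integral_finsetSum _ fun k _ => hint k]
      exact Finset.sum_eq_zero fun k _ => hmean k
    have h2 : Var[S n; P] = ∑ k ∈ Finset.range (n + 1), Var[η k; P] :=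
      IndepFun.variance_sum (fun k _ => hL2 k) fun i _ j _ hij => hind.indepFun hij
    rw [variance_of_integral_eq_zero (hSL2 n).aestronglyMeasurable.aemeasurable h1] at h2
    rw [h2]
    exact hsum.sum_le_tsum _ fun k _ => variance_nonneg _ _
  have hbdd : ∀ n, eLpNorm (S n) 1 P ≤ (1 + ∑' k, Var[η k; P]).toNNReal := by
    intro n
    rw [eLpNorm_one_eq_lintegral_enorm, ← ofReal_integral_norm_eq_lintegral_enorm (hSint n)]
    refine ENNReal.ofReal_le_ofReal ?_
    calc ∫ ω, ‖S n ω‖ ∂P ≤ ∫ ω, (1 + S n ω ^ 2) ∂P := by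
          refine integral_mono (hSint n).norm ((integrable_const 1).add (hSL2 n).integrable_sq)
            fun ω => ?_
          rw [Real.norm_eq_abs]
          nlinarith [sq_abs (S n ω), sq_nonneg (|S n ω| - 1), abs_nonneg (S n ω)]
      _ = 1 + ∫ ω, S n ω ^ 2 ∂P := by
          rw [integral_add (integrable_const 1) (hSL2 n).integrable_sq]; simp
      _ ≤ _ := by gcongr; exact hvar n
  filter_upwards [hmart.submartingale.ae_tendsto_limitProcess hbdd] with ω hω
  refine ⟨_, (tendsto_add_atTop_iff_nat 1).mp (hω.congr fun n => ?_)⟩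
  simp [hS]

/-- A series of independent centred variables whose `p`-th absolute moments are summable for some
`p ∈ [1, 2]` converges almost surely. -/
theorem ae_exists_tendsto_sum_of_summable_moment {ζ : ℕ → Ω → ℝ} {p : ℝ} (hp1 : 1 ≤ p)
    (hp2 : p ≤ 2) (hmeas : ∀ k, Measurable (ζ k)) (hint : ∀ k, Integrable (ζ k) P)
    (hind : iIndepFun ζ P) (hmean : ∀ k, ∫ ω, ζ k ω ∂P = 0)
    (hsum : ∑' k, ∫⁻ ω, ENNReal.ofReal (|ζ k ω| ^ p) ∂P ≠ ∞) :
    ∀ᵐ ω ∂P, ∃ c, Tendsto (fun n => ∑ k ∈ Finset.range n, ζ k ω) atTop (𝓝 c) := by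
  -- Truncation at `1`, as in the three-series theorem: `p ≤ 2` lets `|x| ^ p` dominate the square
  -- of the kept part, and `1 ≤ p` lets it dominate the discarded part.
  set φ : ℝ → ℝ := fun x => if |x| ≤ 1 then x else 0 with hφ
  have hφm : Measurable φ :=
    Measurable.ite (measurableSet_le measurable_norm measurable_const) measurable_id
      measurable_const
  have hφb : ∀ x, |φ x| ≤ 1 := fun x => by
    simp only [hφ]; split_ifs with h <;> simp [h]
  have hφsq : ∀ x, φ x ^ 2 ≤ |x| ^ p := fun x => by
    simp only [hφ]
    split_ifs with h
    · rw [← sq_abs, ← Real.rpow_two]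
      rcases (abs_nonneg x).eq_or_lt with h0 | h0
      · rw [← h0, Real.zero_rpow (by norm_num), Real.zero_rpow (by linarith)]
      · exact Real.rpow_le_rpow_of_exponent_ge h0 h hp2
    · simpa using Real.rpow_nonneg (abs_nonneg x) p
  have hφd : ∀ x, |x - φ x| ≤ |x| ^ p := fun x => by
    simp only [hφ]
    split_ifs with h
    · simpa using Real.rpow_nonneg (abs_nonneg x) p
    · rw [sub_zero]
      exact Real.self_le_rpow_of_one_le (not_le.mp h).le hp1
  have hbm : ∀ k, Measurable fun ω => φ (ζ k ω) := fun k => hφm.comp (hmeas k)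
  have hbL : ∀ k, MemLp (fun ω => φ (ζ k ω)) 2 P := fun k =>
    MemLp.of_bound (hbm k).aestronglyMeasurable 1 (ae_of_all _ fun ω => hφb _)
  have hbi : ∀ k, Integrable (fun ω => φ (ζ k ω)) P := fun k => (hbL k).integrable (by norm_num)
  have hM : Summable fun k => (∫⁻ ω, ENNReal.ofReal (|ζ k ω| ^ p) ∂P).toReal :=
    ENNReal.summable_toReal hsum
  have hMk : ∀ k, ∫⁻ ω, ENNReal.ofReal (|ζ k ω| ^ p) ∂P ≠ ∞ := fun k =>
    ENNReal.ne_top_of_tsum_ne_top hsum k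
  have key : ∀ (k : ℕ) (g : Ω → ℝ), Measurable g → (∀ ω, 0 ≤ g ω) →
      (∀ ω, g ω ≤ |ζ k ω| ^ p) →
      ∫ ω, g ω ∂P ≤ (∫⁻ ω, ENNReal.ofReal (|ζ k ω| ^ p) ∂P).toReal := by
    intro k g hg h0 h1
    rw [integral_eq_lintegral_of_nonneg_ae (ae_of_all _ h0) hg.aestronglyMeasurable]
    exact ENNReal.toReal_mono (hMk k) (lintegral_mono fun ω => ENNReal.ofReal_le_ofReal (h1 ω))
  have h1 : ∀ᵐ ω ∂P, ∃ c, Tendsto (fun n => ∑ k ∈ Finset.range n,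
      (φ (ζ k ω) - ∫ ω', φ (ζ k ω') ∂P)) atTop (𝓝 c) := by
    refine ae_exists_tendsto_sum_of_summable_variance (fun k => (hbm k).sub_const _)
      (fun k => (hbL k).sub (memLp_const _)) ?_ (fun k => ?_) ?_
    · exact hind.comp (fun k x => φ x - ∫ ω', φ (ζ k ω') ∂P) fun k => hφm.sub_const _
    · rw [integral_sub (hbi k) (integrable_const _)]; simp
    · refine hM.of_nonneg_of_le (fun k => variance_nonneg _ _) fun k => ?_
      rw [variance_sub_const (hbm k).aestronglyMeasurable]
      refine (variance_le_expectation_sq (hbm k).aestronglyMeasurable).trans ?_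
      exact key k _ ((hbm k).pow_const 2) (fun ω => sq_nonneg _) fun ω => hφsq _
  have h2 : Summable fun k => ∫ ω', φ (ζ k ω') ∂P := by
    refine Summable.of_norm_bounded hM fun k => ?_
    -- Since `ζ k` is centred, the truncated mean is minus the mean of the discarded part.
    have : ∫ ω', φ (ζ k ω') ∂P = - ∫ ω', (ζ k ω' - φ (ζ k ω')) ∂P := by
      rw [integral_sub (hint k) (hbi k), hmean]; ring
    rw [this, norm_neg]
    refine (norm_integral_le_integral_norm _).trans ?_
    exact key k _ ((hmeas k).sub (hbm k)).norm (fun ω => norm_nonneg _) fun ω => hφd _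
  have h3 : ∀ᵐ ω ∂P, Summable fun k => ζ k ω - φ (ζ k ω) := by
    refine ae_summable_of_tsum_lintegral_ne_top (fun k => (hmeas k).sub (hbm k)) ?_
    refine ne_top_of_le_ne_top hsum (ENNReal.tsum_le_tsum fun k => ?_)
    exact lintegral_mono fun ω => ENNReal.ofReal_le_ofReal (hφd _)
  filter_upwards [h1, h3] with ω ⟨c, hc⟩ h3
  refine ⟨_, ((hc.add h2.hasSum.tendsto_sum_nat).add h3.hasSum.tendsto_sum_nat).congr fun n => ?_⟩
  rw [← Finset.sum_add_distrib, ← Finset.sum_add_distrib]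
  exact Finset.sum_congr rfl fun k _ => by ring

/-- A tail bound of order `x ^ (-β)` bounds the absolute moments of order `p < β`. -/
theorem exists_lintegral_rpow_le_of_tail (P : Measure Ω) [IsProbabilityMeasure P] {p β : ℝ}
    (hp : 1 ≤ p) (hpβ : p < β) (C : ℝ) :
    ∃ K : ℝ≥0, ∀ Z : Ω → ℝ, Measurable Z →
      (∀ x : ℝ, 0 < x → P {ω | x < |Z ω|} ≤ ENNReal.ofReal (C / x ^ β)) →
      ∫⁻ ω, ENNReal.ofReal (|Z ω| ^ p) ∂P ≤ K := by
  have hI : ∫⁻ x in Set.Ioi (1 : ℝ), ENNReal.ofReal (C * x ^ (p - 1 - β)) ≠ ∞ := by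
    have := ((integrableOn_Ioi_rpow_of_lt (by linarith : p - 1 - β < -1) one_pos).const_mul
      C).lintegral_lt_top
    exact this.ne
  refine ⟨(ENNReal.ofReal p *
    (1 + ∫⁻ x in Set.Ioi (1 : ℝ), ENNReal.ofReal (C * x ^ (p - 1 - β)))).toNNReal,
    fun Z hZ htail => ?_⟩
  rw [ENNReal.coe_toNNReal (by finiteness),
    lintegral_rpow_eq_lintegral_meas_lt_mul P (ae_of_all _ fun ω => abs_nonneg _)
      hZ.norm.aemeasurable (by linarith), ← Set.Ioc_union_Ioi_eq_Ioi zero_le_one,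
    lintegral_union measurableSet_Ioi (Set.Ioc_disjoint_Ioi le_rfl)]
  refine mul_le_mul_right (add_le_add ?_ ?_) _
  · calc _ ≤ ∫⁻ _ in Set.Ioc (0 : ℝ) 1, 1 := by
          refine setLIntegral_mono measurable_const fun x hx => ?_
          refine mul_le_one' prob_le_one ?_
          rw [ENNReal.ofReal_le_one]
          exact Real.rpow_le_one hx.1.le hx.2 (by linarith)
      _ = 1 := by simp
  · refine setLIntegral_mono (by fun_prop) fun x hx => ?_
    have hx0 : (0 : ℝ) < x := zero_lt_one.trans hx
    refine (mul_le_mul_left (htail x hx0) _).trans ?_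
    rw [← ENNReal.ofReal_mul' (by positivity)]
    refine ENNReal.ofReal_le_ofReal (le_of_eq ?_)
    rw [Real.rpow_sub hx0 (p - 1) β]; ring

end Series

/-! ### Deterministic summation against the cumulative masses. -/

/-- Kronecker's lemma for the weights `cumMass m`. -/
theorem isLittleO_sum_cumMass_mul {m : ℕ → ℝ≥0} {y : ℕ → ℝ} {c : ℝ}
    (hM : Tendsto (fun n => (cumMass m n : ℝ)) atTop atTop)
    (hy : Tendsto (fun n => ∑ k ∈ Finset.range n, y k) atTop (𝓝 c)) :
    (fun n => ∑ k ∈ Finset.range n, (cumMass m (k + 1) : ℝ) * y k)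
      =o[atTop] fun n => (cumMass m n : ℝ) := by
  set R : ℕ → ℝ := fun n => (∑ k ∈ Finset.range n, y k) - c with hR
  have hR0 : Tendsto R atTop (𝓝 0) := by simpa [hR] using hy.sub_const c
  have hRo : R =o[atTop] (fun _ => (1 : ℝ)) := (Asymptotics.isLittleO_one_iff ℝ).mpr hR0
  have hcast : ∀ n, (cumMass m n : ℝ) = ∑ k ∈ Finset.range n, (m k : ℝ) := fun n => by
    simp [cumMass]
  -- Summation by parts against the remainder `R`, which tends to `0`.
  have habel : ∀ n, ∑ k ∈ Finset.range n, (cumMass m (k + 1) : ℝ) * y k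
      = cumMass m n * R n - ∑ k ∈ Finset.range n, (m k : ℝ) * R k := by
    intro n
    induction n with
    | zero => simp [cumMass]
    | succ n ih =>
      have h1 : R (n + 1) = R n + y n := by simp only [hR, Finset.sum_range_succ]; ring
      have h2 : (cumMass m (n + 1) : ℝ) = cumMass m n + m n := by
        simp [cumMass, Finset.sum_range_succ]
      rw [Finset.sum_range_succ, Finset.sum_range_succ, ih, h1, h2]; ring
  have h1 : (fun n => (cumMass m n : ℝ) * R n) =o[atTop] fun n => (cumMass m n : ℝ) := by
    simpa using (Asymptotics.isBigO_refl (fun n => (cumMass m n : ℝ)) atTop).mul_isLittleO hRo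
  have h2 : (fun n => ∑ k ∈ Finset.range n, (m k : ℝ) * R k)
      =o[atTop] fun n => (cumMass m n : ℝ) := by
    have h3 : (fun k => (m k : ℝ) * R k) =o[atTop] fun k => (m k : ℝ) := by
      simpa using (Asymptotics.isBigO_refl (fun k => (m k : ℝ)) atTop).mul_isLittleO hRo
    have := h3.sum_range (fun k => (m k).coe_nonneg) (hM.congr hcast)
    exact this.congr_right fun n => (hcast n).symm
  exact (h1.sub h2).congr_left fun n => (habel n).symm

/-- The increments of a nondecreasing sequence are summable against its powers of order less
than `-1`. -/
theorem summable_div_cumMass_rpow (m : ℕ → ℝ≥0) {κ : ℝ} (hκ : 0 < κ) :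
    Summable fun k => (m k : ℝ) / (cumMass m (k + 1) : ℝ) ^ (1 + κ) := by
  have hsucc : ∀ k, (cumMass m (k + 1) : ℝ) = cumMass m k + m k := fun k => by
    simp [cumMass, Finset.sum_range_succ]
  by_cases hz : ∀ n, cumMass m n = 0
  · refine summable_zero.congr fun k => ?_
    have := hsucc k
    rw [hz, hz] at this
    simp only [NNReal.coe_zero, zero_add] at this
    rw [← this]; simp
  push Not at hz
  obtain ⟨N, hN⟩ := hz
  have hmono : Monotone fun n => (cumMass m n : ℝ) :=
    monotone_nat_of_le_succ fun k => by rw [hsucc]; linarith [(m k).coe_nonneg]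
  have hpos : ∀ k, 0 < (cumMass m (k + N) : ℝ) := fun k =>
    lt_of_lt_of_le (NNReal.coe_pos.mpr (pos_iff_ne_zero.mpr hN)) (hmono (Nat.le_add_left N k))
  -- Comparison with the integral of `x ^ (-1 - κ)` over `[a, b]`; the right-hand side telescopes.
  have hstep : ∀ a b : ℝ, 0 < a → a ≤ b → (b - a) / b ^ (1 + κ) ≤ (a ^ (-κ) - b ^ (-κ)) / κ := by
    intro a b ha hab
    have hb : 0 < b := ha.trans_le hab
    rw [le_div_iff₀ hκ, Real.rpow_neg ha.le, Real.rpow_neg hb.le, Real.rpow_add hb, Real.rpow_one]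
    have hbern : 1 + κ * (1 - a / b) ≤ (b / a) ^ κ := by
      have h1 := Real.add_one_le_exp (κ * (1 - a / b))
      refine le_trans (by linarith) (h1.trans ?_)
      rw [Real.rpow_def_of_pos (by positivity)]
      apply Real.exp_le_exp.mpr
      have h2 := Real.one_sub_inv_le_log_of_pos (show 0 < b / a by positivity)
      rw [inv_div] at h2
      nlinarith
    rw [Real.div_rpow hb.le ha.le] at hbern
    have hbk : 0 < b ^ κ := by positivity
    have hak : 0 < a ^ κ := by positivity
    calc (b - a) / (b * b ^ κ) * κ = (κ * (1 - a / b)) / b ^ κ := by field_simp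
      _ ≤ (b ^ κ / a ^ κ - 1) / b ^ κ := by gcongr; linarith
      _ = _ := by field_simp
  rw [← summable_nat_add_iff N]
  refine summable_of_sum_range_le (c := (cumMass m N : ℝ) ^ (-κ) / κ)
    (fun k => by positivity) fun n => ?_
  calc _ ≤ ∑ k ∈ Finset.range n, ((cumMass m (k + N) : ℝ) ^ (-κ) / κ
            - (cumMass m (k + 1 + N) : ℝ) ^ (-κ) / κ) := by
        refine Finset.sum_le_sum fun k _ => ?_
        have := hstep _ (cumMass m (k + N + 1)) (hpos k) (hmono (Nat.le_succ (k + N)))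
        rw [hsucc (k + N)] at this
        rw [show k + 1 + N = k + N + 1 by ring, hsucc (k + N), ← sub_div]
        simpa using this
    _ ≤ _ := by
        rw [Finset.sum_range_sub']
        simp only [zero_add, sub_le_self_iff]
        positivity

/-! ### Uniform tail bounds and their transfer to the centred family. -/

section Tails

variable {Ω : Type*} [MeasurableSpace Ω]

/-- A uniform tail bound at level `ε`, polynomially decaying in the parameter. -/
def PowerTail (P : Measure Ω) (Y : ℕ → ℝ≥0 → Ω → ℝ) (ε δ C : ℝ) : Prop :=
  ∀ (k : ℕ) (r : ℝ≥0), 0 < r → P {ω | ε < |Y k r ω|} ≤ ENNReal.ofReal (C / (r : ℝ) ^ δ)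

/-- A uniform tail bound at level `ε` for the increments of `r ↦ r * Y k r`, including those that
start at `r = 0`. -/
def IncrementTail (P : Measure Ω) (Y : ℕ → ℝ≥0 → Ω → ℝ) (ε β C : ℝ) : Prop :=
  ∀ (k : ℕ) (t r h : ℝ≥0), 0 < t →
    P {ω | ∃ s ≤ h, (t : ℝ) * ε < |((r : ℝ) + s) * Y k (r + s) ω - (r : ℝ) * Y k r ω|}
      ≤ ENNReal.ofReal (C * (h : ℝ) ^ β / (t : ℝ) ^ β)

theorem PolynomialDecay.powerTail {P : Measure Ω} {Y : ℕ → ℝ≥0 → Ω → ℝ}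
    (h : PolynomialDecay P Y) :
    ∃ δ : ℝ, 0 < δ ∧ ∀ ε : ℝ, 0 < ε → ∃ C, PowerTail P Y ε δ C := by
  obtain ⟨δ, hδ, h⟩ := h
  refine ⟨δ, hδ, fun ε hε => ?_⟩
  obtain ⟨C, hC⟩ := h ε hε
  exact ⟨C, fun k r hr => (le_iSup (fun k => P {ω | ε < |Y k r ω|}) k).trans (hC r hr).le⟩

theorem ofReal_abs_integral_le {P : Measure Ω} (f : Ω → ℝ) :
    ENNReal.ofReal |∫ ω, f ω ∂P| ≤ ∫⁻ ω, ENNReal.ofReal |f ω| ∂P := by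
  simpa only [Real.enorm_eq_ofReal_abs] using enorm_integral_le_lintegral_enorm (μ := P) f

/-- One-sided stochastic domination and bounded means give bounded absolute moments. -/
theorem StochasticDomination.exists_lintegral_abs_le {P : Measure Ω} {Y : ℕ → ℝ≥0 → Ω → ℝ}
    (h : StochasticDomination P Y) (hmeas : ∀ k r, Measurable (Y k r))
    (hint : ∀ k r, Integrable (Y k r) P) {B : ℝ} (hB : ∀ k r, |∫ ω, Y k r ω ∂P| ≤ B) :
    ∃ A : ℝ≥0, ∀ k r, ∫⁻ ω, ENNReal.ofReal |Y k r ω| ∂P ≤ A := by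
  obtain ⟨ν, γ, hν, hγ, hmom, hdom⟩ := h
  set D := ∫⁻ x, ENNReal.ofReal (max x 0) ∂ν with hD
  have hDfin : D ≠ ∞ := by
    refine ne_top_of_le_ne_top (b := 1 + ∫⁻ x, ENNReal.ofReal (|x| ^ (2 + γ)) ∂ν)
      (by finiteness) ?_
    calc D ≤ ∫⁻ x, (1 + ENNReal.ofReal (|x| ^ (2 + γ))) ∂ν := by
          refine lintegral_mono fun x => ?_
          rw [← ENNReal.ofReal_one, ← ENNReal.ofReal_add zero_le_one (by positivity)]
          refine ENNReal.ofReal_le_ofReal ?_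
          rcases le_total |x| 1 with hx | hx
          · have := Real.rpow_nonneg (abs_nonneg x) (2 + γ)
            exact max_le (by linarith [le_abs_self x]) (by linarith)
          · have := Real.self_le_rpow_of_one_le hx (by linarith : 1 ≤ 2 + γ)
            exact max_le (by linarith [le_abs_self x]) (by positivity)
      _ = _ := by rw [lintegral_add_left measurable_const]; simp
  have hpos : ∀ k r, ∫⁻ ω, ENNReal.ofReal (max (Y k r ω) 0) ∂P ≤ D := by
    intro k r
    rw [hD, lintegral_eq_lintegral_meas_lt P (f := fun ω => max (Y k r ω) 0)
        (ae_of_all _ fun ω => le_max_right _ _)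
        ((hmeas k r).max measurable_const).aemeasurable,
      lintegral_eq_lintegral_meas_lt ν (f := fun x => max x 0)
        (ae_of_all _ fun ω => le_max_right _ _)
        (measurable_id.max measurable_const).aemeasurable]
    refine setLIntegral_mono' measurableSet_Ioi fun x (hx : 0 < x) => ?_
    have h1 : ∀ y : ℝ, x < max y 0 ↔ x < y := fun y => by simp [hx.le]
    simp only [h1]
    refine le_trans ?_ (hdom x)
    exact (le_iSup (fun r => P {ω | x < Y k r ω}) r).trans
      (le_iSup (fun k => ⨆ r, P {ω | x < Y k r ω}) k)
  refine ⟨(2 * D.toReal + B).toNNReal, fun k r => ?_⟩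
  have hmaxint : Integrable (fun ω => max (Y k r ω) 0) P := (hint k r).pos_part
  rw [← ofReal_integral_eq_lintegral_ofReal (hint k r).abs (ae_of_all _ fun ω => abs_nonneg _)]
  refine ENNReal.ofReal_le_ofReal ?_
  have h1 : ∫ ω, max (Y k r ω) 0 ∂P ≤ D.toReal := by
    rw [integral_eq_lintegral_of_nonneg_ae (f := fun ω => max (Y k r ω) 0)
      (ae_of_all _ fun ω => le_max_right _ _)
      hmaxint.aestronglyMeasurable]
    exact ENNReal.toReal_mono hDfin (hpos k r)
  -- Domination controls only the positive part; `|y| = 2 y⁺ - y` recovers the negative part from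
  -- the mean.
  have h2 : ∫ ω, |Y k r ω| ∂P = 2 * ∫ ω, max (Y k r ω) 0 ∂P - ∫ ω, Y k r ω ∂P := by
    rw [← integral_const_mul, ← integral_sub (hmaxint.const_mul 2) (hint k r)]
    refine integral_congr_ae (ae_of_all _ fun ω => ?_)
    change |Y k r ω| = 2 * max (Y k r ω) 0 - Y k r ω
    rcases le_total 0 (Y k r ω) with h | h
    · rw [abs_of_nonneg h, max_eq_left h]; ring
    · rw [abs_of_nonpos h, max_eq_right h]; ring
  linarith [neg_abs_le (∫ ω, Y k r ω ∂P), hB k r]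

/-- Bounded first moments make these terms absolutely summable, by a geometric series. This supplies
the value at `0` from which increments start. -/
theorem ae_tendsto_pow_mul_zero {P : Measure Ω} {Y : ℕ → ℝ≥0 → Ω → ℝ}
    (hmeas : ∀ k r, Measurable (Y k r)) {A : ℝ≥0}
    (hA : ∀ k r, ∫⁻ ω, ENNReal.ofReal |Y k r ω| ∂P ≤ A) (k : ℕ) :
    ∀ᵐ ω ∂P, Tendsto (fun n : ℕ => (((1 / 2 : ℝ≥0) ^ n : ℝ≥0) : ℝ) * Y k ((1 / 2) ^ n) ω)
      atTop (𝓝 0) := by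
  have := ae_summable_of_tsum_lintegral_ne_top (P := P)
    (f := fun (n : ℕ) ω => (((1 / 2 : ℝ≥0) ^ n : ℝ≥0) : ℝ) * Y k ((1 / 2) ^ n) ω)
    (fun n => (hmeas k _).const_mul _) ?_
  · filter_upwards [this] with ω hω using hω.tendsto_atTop_zero
  · have hb : ∀ n : ℕ, ∫⁻ ω, ENNReal.ofReal
        |(((1 / 2 : ℝ≥0) ^ n : ℝ≥0) : ℝ) * Y k ((1 / 2) ^ n) ω| ∂P ≤ 2⁻¹ ^ n * (A : ℝ≥0∞) := by
      intro n
      simp only [abs_mul, NNReal.abs_eq]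
      simp only [ENNReal.ofReal_mul (NNReal.coe_nonneg _), ENNReal.ofReal_coe_nnreal]
      rw [lintegral_const_mul' _ _ ENNReal.coe_ne_top]
      refine mul_le_mul' (le_of_eq ?_) (hA k _)
      rw [ENNReal.coe_pow]; simp
    refine ne_top_of_le_ne_top ?_ (ENNReal.tsum_le_tsum hb)
    rw [ENNReal.tsum_mul_right, ENNReal.tsum_geometric, ENNReal.one_sub_inv_two, inv_inv]
    finiteness

/-- Slow relative increment growth extends to increments that start at `0`. -/
theorem SlowIncrementGrowth.incrementTail {P : Measure Ω} {Y : ℕ → ℝ≥0 → Ω → ℝ}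
    (h : SlowIncrementGrowth P Y)
    (hzero : ∀ k, ∀ᵐ ω ∂P, Tendsto
      (fun n : ℕ => (((1 / 2 : ℝ≥0) ^ n : ℝ≥0) : ℝ) * Y k ((1 / 2) ^ n) ω) atTop (𝓝 0))
    {ε : ℝ} (hε : 0 < ε) : ∃ β C : ℝ, 1 < β ∧ 0 < C ∧ IncrementTail P Y ε β C := by
  obtain ⟨β, C, hβ, hC, hbd⟩ := h ε hε
  refine ⟨β, C, hβ, hC, fun k t r h ht => ?_⟩
  rcases eq_or_ne h 0 with rfl | hh
  · have he : {ω | ∃ s ≤ (0 : ℝ≥0),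
        (t : ℝ) * ε < |((r : ℝ) + s) * Y k (r + s) ω - (r : ℝ) * Y k r ω|} = ∅ := by
      ext ω
      simp only [nonpos_iff_eq_zero, exists_eq_left, NNReal.coe_zero, add_zero, sub_self, abs_zero,
        Set.mem_ofPred_eq, Set.mem_empty_iff_false, iff_false, not_lt]
      positivity
    rw [he]; simp
  have hh : 0 < h := pos_iff_ne_zero.mpr hh
  have hpos : ∀ r : ℝ≥0, 0 < r →
      P {ω | ∃ s ≤ h, (t : ℝ) * ε < |((r : ℝ) + s) * Y k (r + s) ω - (r : ℝ) * Y k r ω|}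
        ≤ ENNReal.ofReal (C * (h : ℝ) ^ β / (t : ℝ) ^ β) := by
    intro r hr
    refine le_trans ?_ ((le_iSup (fun k => P {ω | ENNReal.ofReal ((t : ℝ) * ε) ≤
        ⨆ s ∈ Set.Icc (0 : ℝ≥0) h,
          ENNReal.ofReal |((r : ℝ) + s) * Y k (r + s) ω - (r : ℝ) * Y k r ω|}) k).trans
      (hbd t r h ht hr hh))
    refine measure_mono fun ω ⟨s, hs, hlt⟩ => ?_
    exact (ENNReal.ofReal_le_ofReal hlt.le).trans (le_iSup₂_of_le s ⟨zero_le, hs⟩ le_rfl)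
  rcases eq_or_ne r 0 with rfl | hr
  swap
  · exact hpos r (pos_iff_ne_zero.mpr hr)
  -- For `r = 0`, start at `u n ↓ 0` instead. The inequality in the event is strict, so it survives
  -- for all large `n`: the event lies almost surely in the lower limit of the `A n`, each of which
  -- obeys the bound.
  set u : ℕ → ℝ≥0 := fun n => (1 / 2) ^ n with hu
  have hupos : ∀ n, 0 < u n := fun n => by positivity
  have hulim : Tendsto u atTop (𝓝 0) :=
    NNReal.tendsto_pow_atTop_nhds_zero_of_lt_one (NNReal.half_lt_self one_ne_zero)
  set A : ℕ → Set Ω := fun n =>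
    {ω | ∃ s ≤ h, (t : ℝ) * ε < |((u n : ℝ) + s) * Y k (u n + s) ω - (u n : ℝ) * Y k (u n) ω|}
    with hA
  have hmono : Monotone fun N => ⋂ n ≥ N, A n := fun N N' hNN =>
    Set.biInter_mono (fun n (hn : N' ≤ n) => hNN.trans hn) fun _ _ => le_rfl
  calc P {ω | ∃ s ≤ h, (t : ℝ) * ε <
          |(((0 : ℝ≥0) : ℝ) + s) * Y k (0 + s) ω - ((0 : ℝ≥0) : ℝ) * Y k 0 ω|}
      ≤ P (⋃ N, ⋂ n ≥ N, A n) := by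
        refine measure_mono_ae ?_
        filter_upwards [hzero k] with ω hω
        rintro ⟨s, hs, hlt⟩
        simp only [NNReal.coe_zero, zero_add, zero_mul, sub_zero] at hlt
        have hs0 : 0 < s := by
          rcases eq_or_ne s 0 with rfl | h0
          · simp only [NNReal.coe_zero, zero_mul, abs_zero] at hlt
            exact absurd hlt (not_lt.mpr (by positivity))
          · exact pos_iff_ne_zero.mpr h0
        have h1 : ∀ᶠ n in atTop, u n < s := hulim.eventually_lt_const hs0
        have h2 : ∀ᶠ n in atTop, (t : ℝ) * ε < |(s : ℝ) * Y k s ω - (u n : ℝ) * Y k (u n) ω| := by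
          have h3 := (hω.const_sub ((s : ℝ) * Y k s ω)).abs
          rw [sub_zero] at h3
          exact h3.eventually_const_lt hlt
        obtain ⟨N, hN⟩ := eventually_atTop.mp (h1.and h2)
        refine Set.mem_iUnion.mpr ⟨N, Set.mem_iInter₂.mpr fun n hn => ?_⟩
        obtain ⟨h4, h5⟩ := hN n hn
        refine ⟨s - u n, tsub_le_self.trans hs, ?_⟩
        rwa [← NNReal.coe_add, add_tsub_cancel_of_le h4.le]
    _ = ⨆ N, P (⋂ n ≥ N, A n) := hmono.measure_iUnion
    _ ≤ _ := iSup_le fun N =>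
        (measure_mono (Set.biInter_subset_of_mem (show N ∈ {n | n ≥ N} from le_refl N))).trans
          (hpos (u N) (hupos N))

/-- Moment bounds for the difference quotients of `r ↦ r * Y k r`. -/
theorem IncrementTail.exists_lintegral_rpow_le {P : Measure Ω} [IsProbabilityMeasure P]
    {Y : ℕ → ℝ≥0 → Ω → ℝ} {β C : ℝ} (h : IncrementTail P Y 1 β C)
    (hmeas : ∀ k r, Measurable (Y k r)) {p : ℝ} (hp : 1 ≤ p) (hpβ : p < β) :
    ∃ K : ℝ≥0, ∀ (k : ℕ) (r s : ℝ≥0), 0 < s →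
      ∫⁻ ω, ENNReal.ofReal
        (|(((r : ℝ) + s) * Y k (r + s) ω - (r : ℝ) * Y k r ω) / s| ^ p) ∂P ≤ K := by
  obtain ⟨K, hK⟩ := exists_lintegral_rpow_le_of_tail P hp hpβ C
  refine ⟨K, fun k r s hs => hK _ ?_ fun x hx => ?_⟩
  · exact (((hmeas k _).const_mul _).sub ((hmeas k _).const_mul _)).div_const _
  · have hs' : (0 : ℝ) < s := hs
    -- With `t = x * s` and `h = s` the bound `C * h ^ β / t ^ β` becomes `C / x ^ β`.
    have h1 := h k (x.toNNReal * s) r s (mul_pos (Real.toNNReal_pos.mpr hx) hs)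
    rw [NNReal.coe_mul, Real.coe_toNNReal x hx.le, Real.mul_rpow hx.le hs'.le] at h1
    refine (measure_mono ?_).trans (h1.trans_eq ?_)
    · intro ω hω
      refine ⟨s, le_rfl, ?_⟩
      change x < _ at hω
      rwa [abs_div, NNReal.abs_eq, lt_div_iff₀ hs', ← mul_one (x * s)] at hω
    · congr 1
      have : (0 : ℝ) < (s : ℝ) ^ β := by positivity
      field_simp

theorem IncrementTail.exists_lintegral_rpow_le' {P : Measure Ω} [IsProbabilityMeasure P]
    {Y : ℕ → ℝ≥0 → Ω → ℝ} {β C : ℝ} (h : IncrementTail P Y 1 β C)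
    (hmeas : ∀ k r, Measurable (Y k r)) {p : ℝ} (hp : 1 ≤ p) (hpβ : p < β) :
    ∃ K : ℝ≥0, ∀ (k : ℕ) (r : ℝ≥0), 0 < r → ∫⁻ ω, ENNReal.ofReal (|Y k r ω| ^ p) ∂P ≤ K := by
  obtain ⟨K, hK⟩ := h.exists_lintegral_rpow_le hmeas hp hpβ
  refine ⟨K, fun k r hr => ?_⟩
  have hr' : (r : ℝ) ≠ 0 := (NNReal.coe_pos.mpr hr).ne'
  simpa [mul_div_cancel_left₀ _ hr'] using hK k 0 r hr

/-- The mean of an increment of length `s` is at most `K * s`. Either this drift stays below half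
the threshold, or `h` is comparable to `t` and the enlarged constant makes the bound trivial. -/
theorem incrementTail_centred {P : Measure Ω} [IsProbabilityMeasure P] {X : ℕ → ℝ≥0 → Ω → ℝ}
    (hmeas : ∀ k r, Measurable (X k r)) (hint : ∀ k r, Integrable (X k r) P)
    (h : ∀ ε : ℝ, 0 < ε → ∃ β C : ℝ, 1 < β ∧ 0 < C ∧ IncrementTail P X ε β C)
    {ε : ℝ} (hε : 0 < ε) : ∃ β C : ℝ, 1 < β ∧ 0 < C ∧ IncrementTail P (centred P X) ε β C := by
  obtain ⟨β₁, C₁, hβ₁, -, h₁⟩ := h 1 one_pos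
  obtain ⟨K, hK⟩ := h₁.exists_lintegral_rpow_le hmeas le_rfl hβ₁
  obtain ⟨β, C, hβ, hC, h₂⟩ := h (ε / 2) (half_pos hε)
  have hmean : ∀ (k : ℕ) (r s : ℝ≥0),
      |((r : ℝ) + s) * (∫ ω, X k (r + s) ω ∂P) - r * ∫ ω, X k r ω ∂P| ≤ K * s := by
    intro k r s
    rcases eq_or_ne s 0 with rfl | hs
    · simp
    have hs : 0 < s := pos_iff_ne_zero.mpr hs
    have hs' : (0 : ℝ) < s := hs
    have h3 := (ofReal_abs_integral_le (P := P) fun ω =>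
      (((r : ℝ) + s) * X k (r + s) ω - (r : ℝ) * X k r ω) / s).trans
        (by simpa using hK k r s hs)
    rw [integral_div, integral_sub ((hint _ _).const_mul _) ((hint _ _).const_mul _),
      integral_const_mul, integral_const_mul, abs_div, NNReal.abs_eq,
      ENNReal.ofReal_le_iff_le_toReal (by simp), ENNReal.coe_toReal, div_le_iff₀ hs'] at h3
    exact h3
  refine ⟨β, C + (2 * K / ε) ^ β, hβ, by positivity, fun k t r h ht => ?_⟩
  have ht' : (0 : ℝ) < t := ht
  rcases le_total ((K : ℝ) * h) (t * (ε / 2)) with hc | hc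
  · refine (measure_mono ?_).trans ((h₂ k t r h ht).trans (ENNReal.ofReal_le_ofReal ?_))
    · rintro ω ⟨s, hs, hlt⟩
      refine ⟨s, hs, ?_⟩
      have h4 : (K : ℝ) * s ≤ K * h := by gcongr
      have h5 : ((r : ℝ) + s) * centred P X k (r + s) ω - (r : ℝ) * centred P X k r ω
          = (((r : ℝ) + s) * X k (r + s) ω - (r : ℝ) * X k r ω)
            - (((r : ℝ) + s) * (∫ ω, X k (r + s) ω ∂P) - r * ∫ ω, X k r ω ∂P) := by
        simp only [centred]; ring
      rw [h5] at hlt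
      have h6 := hlt.trans_le (abs_sub _ _)
      linarith [hmean k r s]
    · gcongr
      exact le_add_of_nonneg_right (by positivity)
  · refine prob_le_one.trans ?_
    rw [ENNReal.one_le_ofReal, le_div_iff₀ (by positivity), one_mul, add_mul]
    have h7 : (t : ℝ) ≤ 2 * K / ε * h := by
      rw [div_mul_eq_mul_div, le_div_iff₀ hε]; linarith
    calc (t : ℝ) ^ β ≤ (2 * K / ε * h) ^ β := by gcongr
      _ = (2 * K / ε) ^ β * (h : ℝ) ^ β := Real.mul_rpow (by positivity) (by positivity)
      _ ≤ _ := le_add_of_nonneg_left (by positivity)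

theorem tendsto_coe_atTop_nhds_top : Tendsto (fun r : ℝ≥0 => (r : ℝ≥0∞)) atTop (𝓝 ∞) :=
  ENNReal.tendsto_coe_nhds_top.mpr tendsto_id

theorem tendsto_const_div_rpow_zero (C : ℝ) {δ : ℝ} (hδ : 0 < δ) :
    Tendsto (fun r : ℝ≥0 => C / (r : ℝ) ^ δ) atTop (𝓝 0) :=
  tendsto_const_nhds.div_atTop ((tendsto_rpow_atTop hδ).comp (NNReal.tendsto_coe_atTop.mpr tendsto_id))

/-- A polynomially decaying family with bounded `p`-th moments, `p > 1`, has mean `0` at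
infinity. -/
theorem apply_top_eq_zero_of_powerTail {P : Measure Ω} [IsProbabilityMeasure P]
    {X : ℕ → ℝ≥0 → Ω → ℝ} (hmeas : ∀ k r, Measurable (X k r)) {v : ℝ≥0∞ →ᵇ ℝ}
    (hmean : ∀ (k : ℕ) (r : ℝ≥0), ∫ ω, X k r ω ∂P = v r) {δ : ℝ} (hδ : 0 < δ)
    (htail : ∀ ε : ℝ, 0 < ε → ∃ C, PowerTail P X ε δ C) {p : ℝ} (hp : 1 < p) {K : ℝ≥0}
    (hK : ∀ (k : ℕ) (r : ℝ≥0), 0 < r → ∫⁻ ω, ENNReal.ofReal (|X k r ω| ^ p) ∂P ≤ K) :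
    v ∞ = 0 := by
  have hv : Tendsto (fun r : ℝ≥0 => |v r|) atTop (𝓝 |v ∞|) :=
    ((v.continuous.tendsto ∞).comp tendsto_coe_atTop_nhds_top).abs
  have key : ∀ ε : ℝ, 0 < ε → |v ∞| ≤ ε := by
    intro ε hε
    obtain ⟨C, hC⟩ := htail ε hε
    -- Split `|X 0 r|` at the levels `ε` and `A`: the middle range vanishes as `r → ∞` by the tail
    -- bound, the top range is at most `A ^ (1 - p) * K`. Afterwards `A → ∞`.
    have hA : ∀ A : ℝ, 0 < A → |v ∞| ≤ ε + A ^ (1 - p) * K := by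
      intro A hA
      have hlim : Tendsto (fun r : ℝ≥0 => ε + A * (|C| / (r : ℝ) ^ δ) + A ^ (1 - p) * K) atTop
          (𝓝 (ε + A * 0 + A ^ (1 - p) * K)) :=
        (((tendsto_const_div_rpow_zero |C| hδ).const_mul A).const_add ε).add_const _
      rw [mul_zero, add_zero] at hlim
      refine le_of_tendsto_of_tendsto hv hlim ?_
      filter_upwards [eventually_gt_atTop 0] with r hr
      have hr' : (0 : ℝ) < r := hr
      rw [← ENNReal.ofReal_le_ofReal_iff (by positivity), ← hmean 0 r]
      refine (ofReal_abs_integral_le _).trans ?_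
      have hmS : MeasurableSet {ω | ε < |X 0 r ω|} :=
        measurableSet_lt measurable_const (hmeas 0 r).norm
      calc ∫⁻ ω, ENNReal.ofReal |X 0 r ω| ∂P
          ≤ ∫⁻ ω, (ENNReal.ofReal ε
              + {ω | ε < |X 0 r ω|}.indicator (fun _ => ENNReal.ofReal A) ω
              + ENNReal.ofReal (A ^ (1 - p)) * ENNReal.ofReal (|X 0 r ω| ^ p)) ∂P := by
            refine lintegral_mono fun ω => ?_
            rcases le_or_gt |X 0 r ω| ε with h1 | h1
            · exact (ENNReal.ofReal_le_ofReal h1).trans (le_self_add.trans le_self_add)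
            have hmem : ω ∈ {ω | ε < |X 0 r ω|} := h1
            rw [Set.indicator_of_mem hmem]
            rcases le_or_gt |X 0 r ω| A with h2 | h2
            · exact (ENNReal.ofReal_le_ofReal h2).trans (le_add_self.trans le_self_add)
            · refine le_trans ?_ le_add_self
              rw [← ENNReal.ofReal_mul (by positivity)]
              refine ENNReal.ofReal_le_ofReal ?_
              have h0 : 0 < |X 0 r ω| := hA.trans h2
              calc |X 0 r ω| = |X 0 r ω| ^ (1 - p) * |X 0 r ω| ^ p := by
                    rw [← Real.rpow_add h0]; simp
                _ ≤ _ := by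
                    gcongr ?_ * _
                    exact Real.rpow_le_rpow_of_nonpos hA h2.le (by linarith)
        _ = ENNReal.ofReal ε + ENNReal.ofReal A * P {ω | ε < |X 0 r ω|}
              + ENNReal.ofReal (A ^ (1 - p)) * ∫⁻ ω, ENNReal.ofReal (|X 0 r ω| ^ p) ∂P := by
            rw [lintegral_add_left (f := fun ω => ENNReal.ofReal ε
                + {ω | ε < |X 0 r ω|}.indicator (fun _ => ENNReal.ofReal A) ω)
                ((measurable_const.indicator hmS).const_add _),
              lintegral_add_left measurable_const, lintegral_indicator_const hmS,
              lintegral_const_mul' _ _ ENNReal.ofReal_ne_top]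
            simp
        _ ≤ ENNReal.ofReal ε + ENNReal.ofReal A * ENNReal.ofReal (|C| / (r : ℝ) ^ δ)
              + ENNReal.ofReal (A ^ (1 - p)) * K := by
            gcongr
            · refine (hC 0 r hr).trans (ENNReal.ofReal_le_ofReal ?_)
              gcongr
              exact le_abs_self C
            · exact hK 0 r hr
        _ = _ := by
            rw [ENNReal.ofReal_add (by positivity) (by positivity),
              ENNReal.ofReal_add hε.le (by positivity), ENNReal.ofReal_mul hA.le,
              ENNReal.ofReal_mul (by positivity), ENNReal.ofReal_coe_nnreal]
    have hlim : Tendsto (fun A : ℝ => ε + A ^ (1 - p) * K) atTop (𝓝 (ε + 0 * K)) := by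
      have := tendsto_rpow_neg_atTop (show 0 < p - 1 by linarith)
      rw [neg_sub] at this
      exact (this.mul_const _).const_add _
    rw [zero_mul, add_zero] at hlim
    exact ge_of_tendsto hlim ((eventually_gt_atTop 0).mono hA)
  exact abs_eq_zero.mp (le_antisymm (le_of_forall_pos_le_add fun ε hε => by simpa using key ε hε)
    (abs_nonneg _))

/-- Beyond some `r₀` the mean is at most `ε / 2`; below it, the constant `r₀ ^ δ` makes the bound at
least `1`. -/
theorem powerTail_centred {P : Measure Ω} [IsProbabilityMeasure P] {X : ℕ → ℝ≥0 → Ω → ℝ}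
    {v : ℝ≥0∞ →ᵇ ℝ} (hmean : ∀ (k : ℕ) (r : ℝ≥0), ∫ ω, X k r ω ∂P = v r) (hv : v ∞ = 0)
    {δ : ℝ} (hδ : 0 < δ) (htail : ∀ ε : ℝ, 0 < ε → ∃ C, PowerTail P X ε δ C)
    {ε : ℝ} (hε : 0 < ε) : ∃ C, PowerTail P (centred P X) ε δ C := by
  obtain ⟨C, hC⟩ := htail (ε / 2) (half_pos hε)
  have hlim : Tendsto (fun r : ℝ≥0 => |v r|) atTop (𝓝 0) := by
    have := ((v.continuous.tendsto ∞).comp tendsto_coe_atTop_nhds_top).abs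
    rwa [hv, abs_zero] at this
  obtain ⟨r₀, hr₀⟩ := eventually_atTop.mp (hlim.eventually_le_const (half_pos hε))
  refine ⟨max C ((r₀ : ℝ) ^ δ), fun k r hr => ?_⟩
  have hr' : (0 : ℝ) < r := hr
  rcases le_total r₀ r with h | h
  · refine (measure_mono fun ω (hω : ε < _) => ?_).trans
      ((hC k r hr).trans (ENNReal.ofReal_le_ofReal (by gcongr; exact le_max_left _ _)))
    have h1 := hω.trans_le (abs_sub _ _)
    rw [hmean] at h1
    have := hr₀ r h
    change ε / 2 < _
    linarith
  · refine prob_le_one.trans ?_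
    rw [ENNReal.one_le_ofReal, le_div_iff₀ (by positivity), one_mul]
    refine le_trans ?_ (le_max_right _ _)
    gcongr

end Tails

/-! ### The strong law at completed masses. -/

theorem cumMass_succ (m : ℕ → ℝ≥0) (k : ℕ) : cumMass m (k + 1) = cumMass m k + m k :=
  Finset.sum_range_succ _ _

theorem cumMass_mono (m : ℕ → ℝ≥0) : Monotone (cumMass m) :=
  monotone_nat_of_le_succ fun k => by rw [cumMass_succ]; exact le_self_add

section StrongLaw

variable {Ω : Type*} [MeasurableSpace Ω] {P : Measure Ω} [IsProbabilityMeasure P]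

/-- The strong law of large numbers along the times `cumMass m n`. -/
theorem ae_isLittleO_sum_mul {Y : ℕ → ℝ≥0 → Ω → ℝ} (hmeas : ∀ k r, Measurable (Y k r))
    (hint : ∀ k r, Integrable (Y k r) P) (hmean : ∀ k r, ∫ ω, Y k r ω ∂P = 0)
    (hind : iIndepFun (fun (k : ℕ) (ω : Ω) (r : ℝ≥0) => Y k r ω) P) {δ : ℝ} (hδ : 0 < δ)
    (htail : ∀ ε : ℝ, 0 < ε → ∃ C, PowerTail P Y ε δ C) {p : ℝ} (hp : 1 < p) (hp2 : p ≤ 2)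
    {K : ℝ≥0} (hK : ∀ (k : ℕ) (r : ℝ≥0), 0 < r → ∫⁻ ω, ENNReal.ofReal (|Y k r ω| ^ p) ∂P ≤ K)
    {m : ℕ → ℝ≥0} (hM : Tendsto (fun n => (cumMass m n : ℝ)) atTop atTop) :
    ∀ᵐ ω ∂P, (fun n => ∑ k ∈ Finset.range n, (m k : ℝ) * Y k (m k) ω)
      =o[atTop] fun n => (cumMass m n : ℝ) := by
  classical
  -- Chosen so that `(1 - η) * (1 + δ)` still exceeds `1`, which makes the heavy-mass probabilities
  -- summable.
  set η : ℝ := δ / (2 * (1 + δ)) with hη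
  have hη0 : 0 < η := by positivity
  have hη1 : (1 - η) * (1 + δ) = 1 + δ / 2 := by rw [hη]; field_simp; ring
  set M' : ℕ → ℝ := fun k => cumMass m (k + 1) with hM'
  have hMm : ∀ k, (m k : ℝ) ≤ M' k := fun k => by
    simp only [hM', cumMass_succ, NNReal.coe_add]; linarith [(cumMass m k).coe_nonneg]
  set s : ℕ → ℝ := fun k => if (m k : ℝ) ≤ M' k ^ (1 - η) then (m k : ℝ) / M' k else 0 with hs
  have hM'0 : ∀ k, 0 ≤ M' k := fun k => NNReal.coe_nonneg _
  have hs0 : ∀ k, 0 ≤ s k := fun k => by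
    simp only [hs]; split_ifs
    · exact div_nonneg (m k).coe_nonneg (hM'0 k)
    · exact le_rfl
  have hsp : ∀ k, s k ^ p ≤ m k / M' k ^ (1 + η * (p - 1)) := by
    intro k
    simp only [hs]
    split_ifs with h
    · rcases (m k).coe_nonneg.eq_or_lt with h0 | h0
      · rw [← h0]; simp [Real.zero_rpow (by linarith : p ≠ 0)]
      have hMk : 0 < M' k := h0.trans_le (hMm k)
      have h1 : (m k : ℝ) / M' k ≤ M' k ^ (-η) := by
        rw [div_le_iff₀ hMk]
        refine h.trans_eq ?_
        rw [← Real.rpow_add_one hMk.ne']; ring_nf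
      calc ((m k : ℝ) / M' k) ^ p = (m k / M' k) * (m k / M' k) ^ (p - 1) := by
            rw [← Real.rpow_one_add' (by positivity) (by linarith)]; ring_nf
        _ ≤ (m k / M' k) * (M' k ^ (-η)) ^ (p - 1) := by gcongr
        _ = _ := by
            rw [← Real.rpow_mul hMk.le, neg_mul, Real.rpow_neg hMk.le, Real.rpow_add hMk,
              Real.rpow_one]
            field_simp
    · rw [Real.zero_rpow (by linarith)]
      exact div_nonneg (m k).coe_nonneg (Real.rpow_nonneg (hM'0 k) _)
  have hconv : ∀ᵐ ω ∂P, ∃ c, Tendsto (fun n => ∑ k ∈ Finset.range n, s k * Y k (m k) ω)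
      atTop (𝓝 c) := by
    refine ae_exists_tendsto_sum_of_summable_moment (ζ := fun k ω => s k * Y k (m k) ω) hp.le hp2
      (fun k => (hmeas _ _).const_mul _) (fun k => (hint _ _).const_mul _) ?_
      (fun k => by rw [integral_const_mul, hmean, mul_zero]) ?_
    · exact hind.comp (fun k x => s k * x (m k)) fun k => (measurable_pi_apply (m k)).const_mul _
    · have hb : ∀ k, ∫⁻ ω, ENNReal.ofReal (|s k * Y k (m k) ω| ^ p) ∂P
          ≤ ENNReal.ofReal (m k / M' k ^ (1 + η * (p - 1))) * K := by
        intro k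
        simp only [abs_mul, abs_of_nonneg (hs0 k), Real.mul_rpow (hs0 k) (abs_nonneg _),
          ENNReal.ofReal_mul (Real.rpow_nonneg (hs0 k) p)]
        rw [lintegral_const_mul' _ _ ENNReal.ofReal_ne_top]
        -- The moment bound is available only for positive parameters; a zero mass has weight `0`.
        rcases eq_or_ne (m k) 0 with h0 | h0
        · have : s k = 0 := by simp [hs, h0]
          rw [this, Real.zero_rpow (by linarith)]; simp
        · exact mul_le_mul' (ENNReal.ofReal_le_ofReal (hsp k)) (hK k _ (pos_iff_ne_zero.mpr h0))
      refine ne_top_of_le_ne_top ?_ (ENNReal.tsum_le_tsum hb)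
      rw [ENNReal.tsum_mul_right]
      have := (summable_div_cumMass_rpow m
        (mul_pos hη0 (by linarith : 0 < p - 1))).tsum_ofReal_ne_top
      finiteness
  have hbig : ∀ᵐ ω ∂P, ∀ i : ℕ, ∀ᶠ k in atTop,
      ¬ (M' k ^ (1 - η) < (m k : ℝ) ∧ 1 / ((i : ℝ) + 1) < |Y k (m k) ω|) := by
    rw [ae_all_iff]
    intro i
    obtain ⟨C, hC⟩ := htail (1 / ((i : ℝ) + 1)) (by positivity)
    refine ae_eventually_notMem
      (s := fun k => {ω | M' k ^ (1 - η) < (m k : ℝ) ∧ 1 / ((i : ℝ) + 1) < |Y k (m k) ω|}) ?_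
    have hb : ∀ k, P {ω | M' k ^ (1 - η) < (m k : ℝ) ∧ 1 / ((i : ℝ) + 1) < |Y k (m k) ω|}
        ≤ ENNReal.ofReal (|C| * (m k / M' k ^ (1 + δ / 2))) := by
      intro k
      by_cases hk : M' k ^ (1 - η) < (m k : ℝ)
      swap
      · simp [hk]
      have h0 : (0 : ℝ) < m k := (Real.rpow_nonneg (hM'0 k) _).trans_lt hk
      have hMk : 0 < M' k := h0.trans_le (hMm k)
      refine (measure_mono fun ω hω => hω.2).trans ((hC k (m k) h0).trans ?_)
      refine ENNReal.ofReal_le_ofReal ?_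
      calc C / (m k : ℝ) ^ δ ≤ |C| / (m k : ℝ) ^ δ := by gcongr; exact le_abs_self C
        _ = |C| * (m k / (m k : ℝ) ^ (1 + δ)) := by
            rw [Real.rpow_add h0, Real.rpow_one]; field_simp
        _ ≤ |C| * (m k / (M' k ^ (1 - η)) ^ (1 + δ)) := by gcongr
        _ = _ := by rw [← Real.rpow_mul hMk.le, hη1]
    exact ne_top_of_le_ne_top
      ((summable_div_cumMass_rpow m (half_pos hδ)).mul_left |C|).tsum_ofReal_ne_top
      (ENNReal.tsum_le_tsum hb)
  filter_upwards [hconv, hbig] with ω ⟨c, hc⟩ hbig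
  have h1 := isLittleO_sum_cumMass_mul hM hc
  -- The heavy part: `Y k (m k)` tends to `0` along heavy indices, so these terms are negligible
  -- against `m k`, and their sums against `cumMass m n`.
  set b : ℕ → ℝ := fun k => if (m k : ℝ) ≤ M' k ^ (1 - η) then 0 else m k * Y k (m k) ω with hb
  have h2 : b =o[atTop] fun k => (m k : ℝ) := by
    rw [Asymptotics.isLittleO_iff]
    intro ε hε
    obtain ⟨i, hi⟩ := exists_nat_one_div_lt hε
    filter_upwards [hbig i] with k hk
    simp only [hb, Real.norm_eq_abs, NNReal.abs_eq]
    split_ifs with h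
    · rw [abs_zero]; positivity
    · rw [abs_mul, NNReal.abs_eq, mul_comm]
      have : |Y k (m k) ω| ≤ ε := by
        by_contra hcon
        exact hk ⟨not_le.mp h, hi.trans (not_le.mp hcon)⟩
      gcongr
  have hcast : ∀ n, (cumMass m n : ℝ) = ∑ k ∈ Finset.range n, (m k : ℝ) := fun n => by
    simp [cumMass]
  have h3 := (h2.sum_range (fun k => (m k).coe_nonneg) (hM.congr hcast)).congr_right
    fun n => (hcast n).symm
  refine (h1.add h3).congr_left fun n => ?_
  rw [← Finset.sum_add_distrib]
  refine Finset.sum_congr rfl fun k _ => ?_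
  simp only [hs, hb]
  split_ifs with h
  · rcases (m k).coe_nonneg.eq_or_lt with h0 | h0
    · rw [← h0]; simp
    · have : M' k ≠ 0 := (h0.trans_le (hMm k)).ne'
      change M' k * _ + 0 = _
      field_simp; simp
  · simp

end StrongLaw

/-! ### The unfinished mass, controlled along a time grid. -/

theorem cumMass_ell_pred_lt_and_le {m : ℕ → ℝ≥0}
    (hM : Tendsto (fun n => (cumMass m n : ℝ)) atTop atTop) {t : ℝ≥0} (ht : 0 < t) :
    cumMass m (ell m t - 1) < t ∧ t ≤ cumMass m (ell m t - 1 + 1) := by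
  have hne : {l : ℕ | t ≤ cumMass m l}.Nonempty := by
    obtain ⟨l, hl⟩ := (hM.eventually_ge_atTop (t : ℝ)).exists
    exact ⟨l, hl⟩
  have hmem : t ≤ cumMass m (ell m t) := Nat.sInf_mem hne
  have hpos : ell m t ≠ 0 := fun h0 => by
    rw [h0] at hmem
    exact absurd hmem (not_le.mpr (by simpa [cumMass] using ht))
  refine ⟨?_, by rwa [Nat.sub_add_cancel (Nat.pos_of_ne_zero hpos)]⟩
  have : ell m t - 1 ∉ {l : ℕ | t ≤ cumMass m l} :=
    Nat.notMem_of_lt_sInf (Nat.sub_lt (Nat.pos_of_ne_zero hpos) one_pos)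
  exact not_le.mp this

theorem ell_pred_eq {m : ℕ → ℝ≥0} {t : ℝ≥0} {k : ℕ} (h1 : cumMass m k < t)
    (h2 : t ≤ cumMass m (k + 1)) : ell m t - 1 = k := by
  have : ell m t = k + 1 := by
    refine le_antisymm (Nat.sInf_le h2) (le_csInf ⟨_, h2⟩ fun l hl => ?_)
    by_contra hlt
    exact absurd (h1.trans_le (hl.trans (cumMass_mono m (by lia)))) (lt_irrefl _)
  rw [this]; rfl

/-- The relative length of the `j`-th grid interval is of order `1 / j`, so its `β`-th powers are
summable. -/
theorem add_one_pow_sub_pow_le {x : ℝ} (hx : 1 ≤ x) (a : ℕ) :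
    (x + 1) ^ a - x ^ a ≤ 2 ^ a / x * x ^ a := by
  have hx0 : 0 < x := by linarith
  have key : ∀ (y : ℝ), 0 ≤ y → y ≤ 1 → ∀ a : ℕ, (1 + y) ^ a ≤ 1 + (2 ^ a - 1) * y := by
    intro y hy hy1 a
    induction a with
    | zero => simp
    | succ a ih =>
      have h2 : (1 : ℝ) ≤ 2 ^ a := one_le_pow₀ one_le_two
      calc (1 + y) ^ (a + 1) = (1 + y) ^ a * (1 + y) := pow_succ _ _
        _ ≤ (1 + (2 ^ a - 1) * y) * (1 + y) := by gcongr
        _ ≤ _ := by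
            rw [pow_succ]
            nlinarith [mul_nonneg (sub_nonneg.mpr h2) (mul_nonneg hy (sub_nonneg.mpr hy1))]
  have h1 := key x⁻¹ (by positivity) (inv_le_one_of_one_le₀ hx) a
  have h2 : (x + 1) ^ a = (1 + x⁻¹) ^ a * x ^ a := by
    rw [← mul_pow]; congr 1; field_simp
  have h3 : (1 + x⁻¹) ^ a * x ^ a ≤ (1 + (2 ^ a - 1) * x⁻¹) * x ^ a := by gcongr
  have h4 : 0 < x⁻¹ * x ^ a := by positivity
  rw [h2, div_eq_mul_inv]
  nlinarith

section Fluctuations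

variable {Ω : Type*} [MeasurableSpace Ω] {P : Measure Ω}

/-- The grid `[τ j, τ (j + 1)]` cut at the times `cumMass m k`: the projection of a time to the
`j`-th interval. -/
def clampTime (τ : ℕ → ℝ≥0) (j : ℕ) (x : ℝ≥0) : ℝ≥0 := max (τ j) (min x (τ (j + 1)))

theorem clampTime_mono (τ : ℕ → ℝ≥0) (j : ℕ) : Monotone (clampTime τ j) := fun _ _ h =>
  max_le_max le_rfl (min_le_min h le_rfl)

/-- The event of a large fluctuation on the part of the `k`-th increment in the `j`-th interval. -/
def fluctuation {Ω : Type*} (Y : ℕ → ℝ≥0 → Ω → ℝ) (m : ℕ → ℝ≥0) (τ : ℕ → ℝ≥0) (ε : ℝ) (j k : ℕ) : Set Ω :=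
  {ω | ∃ s ≤ clampTime τ j (cumMass m (k + 1)) - clampTime τ j (cumMass m k),
    (τ j : ℝ) * ε < |(((clampTime τ j (cumMass m k) - cumMass m k : ℝ≥0) : ℝ) + s)
        * Y k (clampTime τ j (cumMass m k) - cumMass m k + s) ω
      - ((clampTime τ j (cumMass m k) - cumMass m k : ℝ≥0) : ℝ)
        * Y k (clampTime τ j (cumMass m k) - cumMass m k) ω|}

/-- As `β > 1`, the `β`-th powers of the lengths of disjoint pieces add up to at most the `β`-th
power of the whole length, so the number of masses meeting the interval is irrelevant. -/
theorem tsum_measure_fluctuation_le {Y : ℕ → ℝ≥0 → Ω → ℝ} {ε β C : ℝ} (hβ : 1 < β) (hC : 0 < C)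
    (hY : IncrementTail P Y ε β C) (m : ℕ → ℝ≥0) {τ : ℕ → ℝ≥0} (hτ : Monotone τ)
    (hτ0 : ∀ j, 0 < τ j) (j : ℕ) :
    ∑' k, P (fluctuation Y m τ ε j k)
      ≤ ENNReal.ofReal (C * (((τ (j + 1) : ℝ) - τ j) / τ j) ^ β) := by
  have hpos : (0 : ℝ) < τ j := hτ0 j
  set c : ℕ → ℝ := fun k => clampTime τ j (cumMass m k) with hc
  have hcm : Monotone c := fun a b h =>
    NNReal.coe_le_coe.mpr (clampTime_mono τ j (cumMass_mono m h))
  have hlow : ∀ k, (τ j : ℝ) ≤ c k := fun k => NNReal.coe_le_coe.mpr (le_max_left _ _)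
  have hup : ∀ k, c k ≤ τ (j + 1) := fun k =>
    NNReal.coe_le_coe.mpr (max_le (hτ (Nat.le_succ j)) (min_le_right _ _))
  have hH : (0 : ℝ) ≤ τ (j + 1) - τ j := sub_nonneg.mpr ((hlow 0).trans (hup 0))
  have hb : ∀ k, P (fluctuation Y m τ ε j k)
      ≤ ENNReal.ofReal (C * ((c (k + 1) - c k) * ((τ (j + 1) : ℝ) - τ j) ^ (β - 1))
          / (τ j : ℝ) ^ β) := by
    intro k
    refine (hY k (τ j) _ _ (hτ0 j)).trans (ENNReal.ofReal_le_ofReal ?_)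
    rw [NNReal.coe_sub (clampTime_mono τ j (cumMass_mono m (Nat.le_succ k)))]
    change C * (c (k + 1) - c k) ^ β / _ ≤ _
    have h0 : 0 ≤ c (k + 1) - c k := sub_nonneg.mpr (hcm (Nat.le_succ k))
    have h1 : c (k + 1) - c k ≤ (τ (j + 1) : ℝ) - τ j := sub_le_sub (hup _) (hlow _)
    gcongr
    calc (c (k + 1) - c k) ^ β = (c (k + 1) - c k) * (c (k + 1) - c k) ^ (β - 1) := by
          rw [← Real.rpow_one_add' h0 (by linarith)]; ring_nf
      _ ≤ _ := by gcongr
  refine (ENNReal.tsum_le_tsum hb).trans (ENNReal.tsum_le_of_sum_range_le fun n => ?_)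
  rw [← ENNReal.ofReal_sum_of_nonneg fun k _ => ?_]
  · refine ENNReal.ofReal_le_ofReal ?_
    rw [← Finset.sum_div, ← Finset.mul_sum, ← Finset.sum_mul, Finset.sum_range_sub,
      Real.div_rpow hH hpos.le, ← mul_div_assoc]
    have h1 : c n - c 0 ≤ (τ (j + 1) : ℝ) - τ j := sub_le_sub (hup _) (hlow _)
    gcongr
    calc (c n - c 0) * ((τ (j + 1) : ℝ) - τ j) ^ (β - 1)
        ≤ ((τ (j + 1) : ℝ) - τ j) * ((τ (j + 1) : ℝ) - τ j) ^ (β - 1) := by gcongr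
      _ = _ := by rw [← Real.rpow_one_add' hH (by linarith)]; ring_nf
  · have h0 : 0 ≤ c (k + 1) - c k := sub_nonneg.mpr (hcm (Nat.le_succ k))
    positivity

/-- Off the exceptional events, the unfinished increment is small. -/
theorem abs_tbar_mul_le {Ω : Type*} {Y : ℕ → ℝ≥0 → Ω → ℝ} {ε : ℝ} (hε : 0 < ε) {m : ℕ → ℝ≥0}
    (hM : Tendsto (fun n => (cumMass m n : ℝ)) atTop atTop) {τ : ℕ → ℝ≥0} {ω : Ω} {j : ℕ} {t : ℝ≥0}
    (hτ0 : 0 < τ j) (hjt : τ j ≤ t) (htj : t < τ (j + 1))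
    (h1 : ω ∉ fluctuation Y m τ ε j (ell m t - 1))
    (h2 : |(tbar m (τ j) : ℝ) * Y (ell m (τ j) - 1) (tbar m (τ j)) ω| ≤ τ j * ε) :
    |(tbar m t : ℝ) * Y (ell m t - 1) (tbar m t) ω| ≤ 2 * ε * t := by
  have ht0 : 0 < t := hτ0.trans_le hjt
  obtain ⟨hk1, hk2⟩ := cumMass_ell_pred_lt_and_le hM ht0
  set k := ell m t - 1 with hk
  have htb : tbar m t = t - cumMass m k := rfl
  have hc1 : clampTime τ j (cumMass m k) = max (τ j) (cumMass m k) := by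
    rw [clampTime, min_eq_left (hk1.trans htj).le]
  have hc2 : t ≤ clampTime τ j (cumMass m (k + 1)) :=
    (le_min hk2 htj.le).trans (le_max_right _ _)
  have hσt : max (τ j) (cumMass m k) ≤ t := max_le hjt hk1.le
  simp only [fluctuation, Set.mem_ofPred_eq, not_exists, not_and, not_lt] at h1
  have h3 := h1 (t - max (τ j) (cumMass m k)) (by rw [hc1]; exact tsub_le_tsub_right hc2 _)
  rw [hc1] at h3
  have hrs : max (τ j) (cumMass m k) - cumMass m k + (t - max (τ j) (cumMass m k)) = tbar m t := by
    rw [htb, add_comm, tsub_add_tsub_cancel hσt (le_max_right _ _)]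
  rw [← NNReal.coe_add, hrs] at h3
  have hstart : |((max (τ j) (cumMass m k) - cumMass m k : ℝ≥0) : ℝ)
      * Y k (max (τ j) (cumMass m k) - cumMass m k) ω| ≤ τ j * ε := by
    -- Either the current mass begins within the grid interval, with starting value `0`, or it is
    -- already under way at `τ j` and `h2` applies.
    rcases le_or_gt (τ j) (cumMass m k) with hle | hlt
    · rw [max_eq_right hle, tsub_self, NNReal.coe_zero, zero_mul, abs_zero]
      positivity
    · have hkj : ell m (τ j) - 1 = k := ell_pred_eq hlt (hjt.trans hk2)
      rw [tbar, hkj] at h2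
      rwa [max_eq_left hlt.le]
  have h4 := abs_sub_abs_le_abs_sub ((tbar m t : ℝ) * Y k (tbar m t) ω)
    (((max (τ j) (cumMass m k) - cumMass m k : ℝ≥0) : ℝ)
      * Y k (max (τ j) (cumMass m k) - cumMass m k) ω)
  have h5 : (τ j : ℝ) * ε ≤ t * ε := by gcongr
  linarith

/-- The polynomial time grid. -/
def gridTime (b j : ℕ) : ℝ≥0 := ((j : ℝ≥0) + 1) ^ (2 * b)

theorem coe_gridTime (b j : ℕ) : (gridTime b j : ℝ) = ((j : ℝ) + 1) ^ (2 * b) := by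
  simp [gridTime]

theorem gridTime_pos (b j : ℕ) : 0 < gridTime b j := by
  unfold gridTime; positivity

theorem gridTime_mono (b : ℕ) : Monotone (gridTime b) := fun i j h => by
  unfold gridTime; gcongr

theorem tendsto_gridTime {b : ℕ} (hb : b ≠ 0) : Tendsto (gridTime b) atTop atTop :=
  tendsto_atTop_mono (fun _ => le_self_add.trans (le_self_pow₀ le_add_self (by lia)))
    (tendsto_natCast_atTop_atTop (R := ℝ≥0))

theorem exists_gridTime_le_lt {b : ℕ} (hb : b ≠ 0) {J : ℕ} {t : ℝ≥0} (ht : gridTime b J ≤ t) :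
    ∃ j, J ≤ j ∧ gridTime b j ≤ t ∧ t < gridTime b (j + 1) := by
  classical
  have hex : ∃ n, t < gridTime b n := ((tendsto_gridTime hb).eventually_gt_atTop t).exists
  have hlt : J < Nat.find hex := by
    by_contra hcon
    exact absurd ((Nat.find_spec hex).trans_le (gridTime_mono b (not_lt.mp hcon))) (not_lt.mpr ht)
  refine ⟨Nat.find hex - 1, by lia, not_lt.mp (Nat.find_min hex (by lia)), ?_⟩
  rw [Nat.sub_add_cancel (by lia)]
  exact Nat.find_spec hex

theorem summable_const_div_add_one_rpow (A : ℝ) {q : ℝ} (hq : 1 < q) :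
    Summable fun j : ℕ => A / ((j : ℝ) + 1) ^ q := by
  have := (summable_nat_add_iff 1).mpr (Real.summable_one_div_nat_rpow.mpr hq)
  refine (this.mul_left A).congr fun j => ?_
  push_cast; ring

/-- Almost surely, only finitely many of the fluctuations along the grid are large. -/
theorem ae_finite_mem_fluctuation {Y : ℕ → ℝ≥0 → Ω → ℝ} {ε β C : ℝ} (hβ : 1 < β) (hC : 0 < C)
    (hinc : IncrementTail P Y ε β C) (m : ℕ → ℝ≥0) (b : ℕ) :
    ∀ᵐ ω ∂P, {x : ℕ × ℕ | ω ∈ fluctuation Y m (gridTime b) ε x.1 x.2}.Finite := by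
  refine ae_finite_setOfPred_mem ?_
  rw [ENNReal.tsum_prod (f := fun j k => P (fluctuation Y m (gridTime b) ε j k))]
  have hbd : ∀ j, ∑' k, P (fluctuation Y m (gridTime b) ε j k)
      ≤ ENNReal.ofReal (C * (2 ^ (2 * b)) ^ β / ((j : ℝ) + 1) ^ β) := by
    intro j
    refine (tsum_measure_fluctuation_le hβ hC hinc m (gridTime_mono b) (gridTime_pos b) j).trans
      (ENNReal.ofReal_le_ofReal ?_)
    rw [mul_div_assoc, ← Real.div_rpow (by positivity) (by positivity)]
    have h1 : (0 : ℝ) ≤ ((gridTime b (j + 1) : ℝ) - gridTime b j) / gridTime b j :=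
      div_nonneg (sub_nonneg.mpr (NNReal.coe_le_coe.mpr (gridTime_mono b (Nat.le_succ j))))
        (NNReal.coe_nonneg _)
    have h2 : ((gridTime b (j + 1) : ℝ) - gridTime b j) / gridTime b j
        ≤ 2 ^ (2 * b) / ((j : ℝ) + 1) := by
      rw [div_le_iff₀ (NNReal.coe_pos.mpr (gridTime_pos b j)), coe_gridTime, coe_gridTime]
      push_cast
      exact add_one_pow_sub_pow_le (by linarith [(Nat.cast_nonneg j : (0 : ℝ) ≤ j)]) _
    exact mul_le_mul_of_nonneg_left (Real.rpow_le_rpow h1 h2 (by linarith)) hC.le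
  exact ne_top_of_le_ne_top (summable_const_div_add_one_rpow _ hβ).tsum_ofReal_ne_top
    (ENNReal.tsum_le_tsum hbd)

/-- The tail of an increment that is under way at a grid time. -/
theorem measure_gridTime_mul_lt_le {Y : ℕ → ℝ≥0 → Ω → ℝ} {ε β C δ C' : ℝ} (hδ : 0 < δ)
    (hβ : 1 < β) (hC : 0 < C) (hinc : IncrementTail P Y ε β C) (htail : PowerTail P Y ε δ C')
    {b : ℕ} (hbβ : 2 ≤ b * β) (hbδ : 2 ≤ b * δ) (j k : ℕ) {u : ℝ≥0} (hu : u ≤ gridTime b j) :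
    P {ω | (gridTime b j : ℝ) * ε < |(u : ℝ) * Y k u ω|}
      ≤ ENNReal.ofReal ((C + |C'|) / ((j : ℝ) + 1) ^ (2 : ℝ)) := by
  have hpow : ∀ q : ℝ, 2 ≤ b * q → ((j : ℝ) + 1) ^ (2 : ℝ) ≤ (((j : ℝ) + 1) ^ b) ^ q := by
    intro q hq
    rw [← Real.rpow_natCast, ← Real.rpow_mul (by positivity)]
    exact Real.rpow_le_rpow_of_exponent_le (by linarith [(Nat.cast_nonneg j : (0 : ℝ) ≤ j)]) hq
  have huτ : (u : ℝ) ≤ gridTime b j := hu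
  have hn : (0 : ℝ) < (j : ℝ) + 1 := by positivity
  -- The threshold is the square root of the grid time: below it, the increment from `0` is short
  -- relative to the grid time; above it, polynomial decay takes over.
  rcases le_or_gt (u : ℝ) (((j : ℝ) + 1) ^ b) with h | h
  · refine (measure_mono ?_).trans ((hinc k (gridTime b j) 0 u (gridTime_pos b j)).trans
      (ENNReal.ofReal_le_ofReal ?_))
    · intro ω hω
      exact ⟨u, le_rfl, by simpa using hω⟩
    · calc C * (u : ℝ) ^ β / (gridTime b j : ℝ) ^ β
          ≤ C * (((j : ℝ) + 1) ^ b) ^ β / (gridTime b j : ℝ) ^ β := by gcongr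
        _ = C / (((j : ℝ) + 1) ^ b) ^ β := by
            rw [coe_gridTime, two_mul, pow_add, Real.mul_rpow (by positivity) (by positivity)]
            have : 0 < (((j : ℝ) + 1) ^ b) ^ β := by positivity
            generalize (((j : ℝ) + 1) ^ b) ^ β = z at this ⊢
            field_simp
        _ ≤ (C + |C'|) / ((j : ℝ) + 1) ^ (2 : ℝ) :=
            div_le_div₀ (by positivity) (le_add_of_nonneg_right (abs_nonneg _)) (by positivity)
              (hpow β hbβ)
  · have hu0 : (0 : ℝ) < u := lt_trans (by positivity) h
    refine (measure_mono ?_).trans ((htail k u hu0).trans (ENNReal.ofReal_le_ofReal ?_))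
    · intro ω hω
      change (gridTime b j : ℝ) * ε < _ at hω
      change ε < |Y k u ω|
      rw [abs_mul, NNReal.abs_eq] at hω
      by_contra hcon
      exact absurd hω (not_lt.mpr (mul_le_mul huτ (not_lt.mp hcon) (abs_nonneg _)
        (NNReal.coe_nonneg _)))
    · calc C' / (u : ℝ) ^ δ ≤ |C'| / (u : ℝ) ^ δ := by gcongr; exact le_abs_self _
        _ ≤ |C'| / (((j : ℝ) + 1) ^ b) ^ δ := by gcongr
        _ ≤ (C + |C'|) / ((j : ℝ) + 1) ^ (2 : ℝ) :=
            div_le_div₀ (by positivity) (le_add_of_nonneg_left hC.le) (by positivity)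
              (hpow δ hbδ)

/-- The unfinished increment is negligible. -/
theorem ae_eventually_abs_tbar_mul_le {Y : ℕ → ℝ≥0 → Ω → ℝ} {δ : ℝ} (hδ : 0 < δ) {ε β C C' : ℝ}
    (hε : 0 < ε) (hβ : 1 < β) (hC : 0 < C) (hinc : IncrementTail P Y ε β C)
    (htail : PowerTail P Y ε δ C') {m : ℕ → ℝ≥0}
    (hM : Tendsto (fun n => (cumMass m n : ℝ)) atTop atTop) :
    ∀ᵐ ω ∂P, ∀ᶠ t : ℝ≥0 in atTop,
      |(tbar m t : ℝ) * Y (ell m t - 1) (tbar m t) ω| ≤ 2 * ε * t := by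
  -- Large enough that both exponents `b * β` and `b * δ` are at least `2`.
  obtain ⟨b, hb⟩ := exists_nat_ge (max 2 (2 / δ))
  have hb2 : (2 : ℝ) ≤ b := (le_max_left _ _).trans hb
  have hbδ : 2 ≤ b * δ := (div_le_iff₀ hδ).mp ((le_max_right _ _).trans hb)
  have hbβ : 2 ≤ b * β := by nlinarith
  have hb0 : b ≠ 0 := fun h => by rw [h, Nat.cast_zero] at hb2; linarith
  have hgrid : ∀ᵐ ω ∂P, ∀ᶠ j in atTop, ω ∉ {ω | (gridTime b j : ℝ) * ε
      < |(tbar m (gridTime b j) : ℝ)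
        * Y (ell m (gridTime b j) - 1) (tbar m (gridTime b j)) ω|} :=
    ae_eventually_notMem <| ne_top_of_le_ne_top
      (summable_const_div_add_one_rpow _ one_lt_two).tsum_ofReal_ne_top
      (ENNReal.tsum_le_tsum fun j =>
        measure_gridTime_mul_lt_le hδ hβ hC hinc htail hbβ hbδ j _ tsub_le_self)
  filter_upwards [ae_finite_mem_fluctuation hβ hC hinc m b, hgrid] with ω hω1 hω2
  obtain ⟨J₁, hJ₁⟩ := (hω1.image Prod.fst).bddAbove
  obtain ⟨J₂, hJ₂⟩ := eventually_atTop.mp hω2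
  filter_upwards [eventually_ge_atTop (gridTime b (max (J₁ + 1) J₂))] with t ht
  obtain ⟨j, hj, hjt, htj⟩ := exists_gridTime_le_lt hb0 ht
  refine abs_tbar_mul_le hε hM (gridTime_pos b j) hjt htj (fun hmem => ?_)
    (not_lt.mp (hJ₂ j ((le_max_right _ _).trans hj)))
  have h1 : j ≤ J₁ := hJ₁ ⟨(j, ell m t - 1), hmem, rfl⟩
  have h2 := (le_max_left _ _).trans hj
  lia

end Fluctuations

/-! ### Means of the gradual sum and assembly of the strong law. -/

theorem tendsto_cumMass_atTop {m : ℕ → ℝ≥0} (hm : ∑' k, (m k : ℝ≥0∞) = ∞) :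
    Tendsto (fun n => (cumMass m n : ℝ)) atTop atTop := by
  refine NNReal.tendsto_coe_atTop.mpr (ENNReal.tendsto_coe_nhds_top.mp ?_)
  rw [← hm]
  refine (ENNReal.tendsto_nat_tsum _).congr fun n => ?_
  simp [cumMass]

theorem integral_empMeasure (v : ℝ≥0∞ →ᵇ ℝ) (m : ℕ → ℝ≥0) (t : ℝ≥0) :
    ∫ x, v x ∂(empMeasure m t)
      = ∑ k ∈ Finset.range (ell m t - 1), (m k : ℝ) / (t : ℝ) * v (m k)
        + (tbar m t : ℝ) / (t : ℝ) * v (tbar m t) := by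
  have hint : ∀ (c : ℝ≥0) (x : ℝ≥0∞), Integrable v (c • Measure.dirac x) := fun c x =>
    Integrable.smul_measure_nnreal (v.integrable _)
  rw [empMeasure, integral_add_measure (hint _ _)
    (integrable_finsetSum_measure.mpr fun k _ => hint _ _),
    integral_finsetSum_measure fun k _ => hint _ _]
  simp only [integral_smul_nnreal_measure, integral_dirac, NNReal.smul_def, NNReal.coe_div,
    smul_eq_mul]
  rw [add_comm]

section GradualSum

variable {Ω : Type*} [MeasurableSpace Ω] {P : Measure Ω}

theorem integrable_gradualSum {X : ℕ → ℝ≥0 → Ω → ℝ} (hint : ∀ k r, Integrable (X k r) P)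
    (m : ℕ → ℝ≥0) (t : ℝ≥0) : Integrable (gradualSum X m t) P :=
  (integrable_finsetSum _ fun _ _ => (hint _ _).const_mul _).add ((hint _ _).const_mul _)

theorem integral_gradualSum {X : ℕ → ℝ≥0 → Ω → ℝ} (hint : ∀ k r, Integrable (X k r) P)
    {v : ℝ≥0∞ →ᵇ ℝ} (hmean : ∀ (k : ℕ) (r : ℝ≥0), ∫ ω, X k r ω ∂P = v r)
    (m : ℕ → ℝ≥0) (t : ℝ≥0) :
    ∫ ω, gradualSum X m t ω ∂P = ∫ x, v x ∂(empMeasure m t) := by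
  simp only [gradualSum]
  rw [integral_add (integrable_finsetSum _ fun k _ => (hint _ _).const_mul _)
    ((hint _ _).const_mul _), integral_finsetSum _ fun k _ => (hint _ _).const_mul _,
    integral_empMeasure]
  simp only [integral_const_mul, hmean]

theorem gradualSum_centred {X : ℕ → ℝ≥0 → Ω → ℝ}
    {v : ℝ≥0∞ →ᵇ ℝ} (hmean : ∀ (k : ℕ) (r : ℝ≥0), ∫ ω, X k r ω ∂P = v r)
    (m : ℕ → ℝ≥0) (t : ℝ≥0) (ω : Ω) :
    gradualSum (centred P X) m t ω = gradualSum X m t ω - ∫ x, v x ∂(empMeasure m t) := by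
  simp only [gradualSum, centred, hmean, integral_empMeasure, mul_sub, Finset.sum_sub_distrib]
  ring

/-- The strong law for the gradual sum of a centred family. -/
theorem ae_tendsto_gradualSum_zero [IsProbabilityMeasure P] {Y : ℕ → ℝ≥0 → Ω → ℝ}
    (hmeas : ∀ k r, Measurable (Y k r)) (hint : ∀ k r, Integrable (Y k r) P)
    (hmean : ∀ k r, ∫ ω, Y k r ω ∂P = 0)
    (hind : iIndepFun (fun (k : ℕ) (ω : Ω) (r : ℝ≥0) => Y k r ω) P) {δ : ℝ} (hδ : 0 < δ)
    (htail : ∀ ε : ℝ, 0 < ε → ∃ C, PowerTail P Y ε δ C)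
    (hinc : ∀ ε : ℝ, 0 < ε → ∃ β C : ℝ, 1 < β ∧ 0 < C ∧ IncrementTail P Y ε β C)
    {m : ℕ → ℝ≥0} (hM : Tendsto (fun n => (cumMass m n : ℝ)) atTop atTop) :
    ∀ᵐ ω ∂P, Tendsto (fun t : ℝ≥0 => gradualSum Y m t ω) atTop (𝓝 0) := by
  obtain ⟨β, C, hβ, -, h1⟩ := hinc 1 one_pos
  obtain ⟨p, hp, hpβ⟩ := exists_between (lt_min hβ one_lt_two)
  obtain ⟨K, hK⟩ := h1.exists_lintegral_rpow_le' hmeas hp.le (hpβ.trans_le (min_le_left _ _))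
  have hlaw := ae_isLittleO_sum_mul hmeas hint hmean hind hδ htail hp
    (hpβ.le.trans (min_le_right _ _)) hK hM
  have hrest : ∀ᵐ ω ∂P, ∀ i : ℕ, ∀ᶠ t : ℝ≥0 in atTop,
      |(tbar m t : ℝ) * Y (ell m t - 1) (tbar m t) ω| ≤ 2 * (1 / ((i : ℝ) + 1)) * t := by
    rw [ae_all_iff]
    intro i
    have hi : (0 : ℝ) < 1 / ((i : ℝ) + 1) := by positivity
    obtain ⟨β, C, hβ, hC, h2⟩ := hinc _ hi
    obtain ⟨C', h3⟩ := htail _ hi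
    exact ae_eventually_abs_tbar_mul_le hδ hi hβ hC h2 h3 hM
  filter_upwards [hlaw, hrest] with ω hlaw hrest
  rw [Metric.tendsto_nhds]
  intro ε hε
  obtain ⟨i, hi⟩ := exists_nat_one_div_lt (show 0 < ε / 4 by positivity)
  obtain ⟨N, hN⟩ := eventually_atTop.mp ((Asymptotics.isLittleO_iff.mp hlaw)
    (show 0 < ε / 4 by positivity))
  filter_upwards [hrest i, eventually_gt_atTop (cumMass m N), eventually_gt_atTop 0]
    with t ht1 ht2 ht0
  obtain ⟨hk1, hk2⟩ := cumMass_ell_pred_lt_and_le hM ht0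
  have ht0' : (0 : ℝ) < t := ht0
  -- Once `t` exceeds `cumMass m N`, the number of completed masses is at least `N`, so the discrete
  -- law applies.
  have hNk : N ≤ ell m t - 1 := by
    by_contra hcon
    exact absurd (ht2.trans_le (hk2.trans (cumMass_mono m (by lia)))) (lt_irrefl _)
  have h4 := hN _ hNk
  rw [Real.norm_eq_abs, Real.norm_eq_abs, NNReal.abs_eq] at h4
  have h5 : gradualSum Y m t ω = ((∑ k ∈ Finset.range (ell m t - 1), (m k : ℝ) * Y k (m k) ω)
      + (tbar m t : ℝ) * Y (ell m t - 1) (tbar m t) ω) / t := by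
    rw [gradualSum, add_div, Finset.sum_div]
    congr 1
    · exact Finset.sum_congr rfl fun k _ => by ring
    · ring
  rw [Real.dist_eq, sub_zero, h5, abs_div, NNReal.abs_eq, div_lt_iff₀ ht0']
  have h6 : ε / 4 * (cumMass m (ell m t - 1) : ℝ) ≤ ε / 4 * t := by
    have : (cumMass m (ell m t - 1) : ℝ) ≤ t := hk1.le
    gcongr
  have h7 : 2 * (1 / ((i : ℝ) + 1)) * t ≤ 2 * (ε / 4) * t := by gcongr
  have h8 := mul_pos hε ht0'
  refine (abs_add_le _ _).trans_lt ?_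
  linarith

/-- Under the three conditions and bounded means, increments that start at `0` are controlled. -/
theorem StrongConditions.incrementTail {Y : ℕ → ℝ≥0 → Ω → ℝ} (h : StrongConditions P Y)
    (hmeas : ∀ k r, Measurable (Y k r)) (hint : ∀ k r, Integrable (Y k r) P) {B : ℝ}
    (hB : ∀ k r, |∫ ω, Y k r ω ∂P| ≤ B) {ε : ℝ} (hε : 0 < ε) :
    ∃ β C : ℝ, 1 < β ∧ 0 < C ∧ IncrementTail P Y ε β C := by
  obtain ⟨A, hA⟩ := h.2.1.exists_lintegral_abs_le hmeas hint hB
  exact h.2.2.incrementTail (ae_tendsto_pow_mul_zero hmeas hA) hε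

end GradualSum

end GameOfMass

theorem mainTheorem5 {Ω : Type*} [MeasurableSpace Ω] (P : Measure Ω) [IsProbabilityMeasure P]
    (X : ℕ → ℝ≥0 → Ω → ℝ)
    (hX_meas : ∀ k r, Measurable (X k r))
    (hX_int : ∀ k r, Integrable (X k r) P)
    (hX_indep : iIndepFun (fun (k : ℕ) (ω : Ω) (r : ℝ≥0) => X k r ω) P)
    (hX_cond : GameOfMass.StrongConditions P X ∨
      GameOfMass.StrongConditions P (GameOfMass.centred P X))
    (v : ℝ≥0∞ →ᵇ ℝ)
    (hX_mean : ∀ (k : ℕ) (r : ℝ≥0), ∫ ω, X k r ω ∂P = v (r : ℝ≥0∞))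
    (m : ℕ → ℝ≥0) (hm : ∑' k, (m k : ℝ≥0∞) = ∞) :
    (∀ t : ℝ≥0, 0 < t →
      Integrable (GameOfMass.gradualSum X m t) P ∧
      ∫ ω, GameOfMass.gradualSum X m t ω ∂P = ∫ x, v x ∂(GameOfMass.empMeasure m t)) ∧
    (∀ μStar : Measure ℝ≥0∞, IsProbabilityMeasure μStar →
      GameOfMass.ConvergesWeakly (GameOfMass.empMeasure m) μStar →
      ∀ᵐ ω ∂P, Tendsto (fun t : ℝ≥0 => GameOfMass.gradualSum X m t ω) atTop
        (𝓝 (∫ x, v x ∂μStar))) := by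
  open GameOfMass in
  refine ⟨fun t _ => ⟨integrable_gradualSum hX_int m t, integral_gradualSum hX_int hX_mean m t⟩,
    fun μStar _ hconv => ?_⟩
  have hcmeas : ∀ k r, Measurable (centred P X k r) := fun k r => (hX_meas k r).sub_const _
  have hcint : ∀ k r, Integrable (centred P X k r) P := fun k r =>
    (hX_int k r).sub (integrable_const _)
  have hcmean : ∀ k r, ∫ ω, centred P X k r ω ∂P = 0 := fun k r => by
    simp only [centred]
    rw [integral_sub (hX_int k r) (integrable_const _)]; simp
  have hcind : iIndepFun (fun (k : ℕ) (ω : Ω) (r : ℝ≥0) => centred P X k r ω) P :=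
    hX_indep.comp (fun k x r => x r - ∫ ω, X k r ω ∂P) fun k =>
      measurable_pi_lambda _ fun r => (measurable_pi_apply r).sub_const _
  obtain ⟨δ, hδ, htail, hinc⟩ : ∃ δ : ℝ, 0 < δ ∧
      (∀ ε : ℝ, 0 < ε → ∃ C, PowerTail P (centred P X) ε δ C) ∧
      ∀ ε : ℝ, 0 < ε → ∃ β C : ℝ, 1 < β ∧ 0 < C ∧ IncrementTail P (centred P X) ε β C := by
    rcases hX_cond with h | h
    · obtain ⟨δ, hδ, htail⟩ := h.1.powerTail
      have hinc : ∀ ε : ℝ, 0 < ε → ∃ β C : ℝ, 1 < β ∧ 0 < C ∧ IncrementTail P X ε β C :=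
        fun ε hε => h.incrementTail hX_meas hX_int (B := ‖v‖)
          (fun k r => by rw [hX_mean]; exact v.norm_coe_le_norm _) hε
      obtain ⟨β, C, hβ, -, h1⟩ := hinc 1 one_pos
      obtain ⟨p, hp, hpβ⟩ := exists_between hβ
      obtain ⟨K, hK⟩ := h1.exists_lintegral_rpow_le' hX_meas hp.le hpβ
      have hv := apply_top_eq_zero_of_powerTail hX_meas hX_mean hδ htail hp hK
      exact ⟨δ, hδ, fun ε hε => powerTail_centred hX_mean hv hδ htail hε,
        fun ε hε => incrementTail_centred hX_meas hX_int hinc hε⟩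
    · obtain ⟨δ, hδ, htail⟩ := h.1.powerTail
      exact ⟨δ, hδ, htail, fun ε hε => h.incrementTail hcmeas hcint (B := 0)
        (fun k r => by rw [hcmean, abs_zero]) hε⟩
  filter_upwards [ae_tendsto_gradualSum_zero hcmeas hcint hcmean hcind hδ htail hinc
    (tendsto_cumMass_atTop hm)] with ω hω
  have := hω.add (hconv v)
  rw [zero_add] at this
  exact this.congr fun t => by rw [gradualSum_centred hX_mean, sub_add_cancel]
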